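/- **Setting.** Let $n\ge 1$. For an $n$-polygraph $P$, $P_{n-1}^\ast$ is the free strict $(n-1)$-category on its underlying $(n-1)$-polygraph. Let $R$ be an $n$-polygraph and $E$ an $n$-polygraph with $E_{\le n-2}=R_{\le n-2}$ and $E_{n-1}\subseteq R_{n-1}$; we regard $E_n$ as a cellular extension of $R_{n-1}^\ast$. Let $R^\ast$ be the free $n$-category on $R$, $E^\top=R_{n-1}^\ast(E_n)$ the free $(n,n-1)$-category on $E_n$ over $R_{n-1}^\ast$ (its $n$-cells are invertible), and $R^\ast(E)$ the free $n$-category over $R_{n-1}^\ast$ on $R_n$ and $E_n$ with the cells of $E_n$ made invertible. A *whisker* is a context $C=f_{n-1}\star_{n-2}(\cdots(f_1\star_0 - \star_0 g_1)\cdots)\star_{n-2}g_{n-1}$ with $f_k,g_k$ $k$-cells of $R_{n-1}^\ast$. The superscript $(1)$ denotes the set of $n$-cells of size one, i.e. $C[\gamma]$ with $C$ a whisker and $\gamma$ a generating $n$-cell (for $E^{\top(1)}$: a generating $n$-cell or the inverse of one). Let ${}_ER_E$ be the cellular extension of $R_{n-1}^\ast$ whose elements are the composable triples $(e,f,e')$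 with $e,e'$ $n$-cells of $E^\top$ and $f\in R^{\ast(1)}$, with source $\partial_-(e)$ and target $\partial_+(e')$. An *$n$-polygraph modulo* $(R,E,S)$ consists of such $R,E$ and a cellular extension $S$ with $R\subseteq S\subseteq{}_ER_E$, where $\rho\in R_n$ is identified with $(1,\rho,1)$; $S^\ast$ is the free $n$-category on $S$ over $R_{n-1}^\ast$. The extension ${}_ER_E$ is *terminating* if there is no infinite sequence $(u_k)_{k\ge0}$ of $(n-1)$-cells with a non-identity $n$-cell $u_k\to u_{k+1}$ in $({}_ER_E)^\ast$ for every $k$. **Squares.** A *square extension* $\Gamma$ of $(E^\top,S^\ast)$ is a set whose elements $A$ have a boundary consisting of horizontal $n$-cells $f:u\to u'$ (top) and $g:v\to v'$ (bottom) of $S^\ast$ and vertical $n$-cells $e:u\to v$ (left) and $e':u'\to v'$ (right) of $E^\top$. For such $A$ and $n$-cells $e_1,e_2$ of $E^\top$ with $\partial_+(e_1)=u$ and $\partial_-(e_2)=v$, let ${}^{e_1}_{e_2}A$ be a square with top $e_1f$, bottom $e_2^-g$, left side $e_1ee_2$ and right side $e'$, whenever the composites $e_1f$ and $e_2^-g$,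 formed in $R^\ast(E)$, are (images of) $n$-cells of $S^\ast$; $E\rtimes\Gamma$ is the set of all these squares. The Peiffer squares are, for $0\le i\le n-2$, $f:u\to u'$ in $S^\ast$ and $e:v\to v'$ in $E^\top$, the squares with top $f\star_i v$, bottom $f\star_i v'$, left side $u\star_i e$, right side $u'\star_i e$, and those with top $v\star_i f$, bottom $v'\star_i f$, left side $e\star_i u$, right side $e\star_i u'$. Let $\Gamma^{c}$ be the free $(n-1)$-category enriched in double categories, with invertible vertical cells and with squares invertible for the pasting along horizontal cells, generated by $E$, $S$, $E\rtimes\Gamma$ and the Peiffer squares. **Branchings.** A *branching modulo $E$* is a triple $(f,e,g)$ with $f,g$ $n$-cells of $S^\ast$, $f$ not an identity, and $e$ an $n$-cell of $E^\top$ from $\partial_-(f)$ to $\partial_-(g)$; it is written $(f,g)$ if $e$ is an identity (then $(f,g)$ and $(g,f)$ are not distinguished) and $(f,e)$ if $g$ is an identity. It is *$\Gamma$-confluent modulo $E$* if there are $n$-cells $f',g'$ of $S^\ast$ and $e'$ of $E^\top$ and a square cell of $\Gamma^{c}$ with top $f\star_{n-1}f'$, bottom $g\star_{n-1}g'$, left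 side $e$ and right side $e'$. It is *local* if $f\in S^{\ast(1)}$ and either $g\in S^{\ast(1)}$ and $e$ is an identity, or $g$ is an identity and $e\in E^{\top(1)}$. A local branching is *overlapping* if it is neither of the form $(f,f)$, nor of the form $(f\star_i v,u\star_i g)$ with $f:u\to u'$ and $g:v\to v'$ in $S^{\ast(1)}$, nor of the form $(f\star_i v,u\star_i e)$ or $(v\star_i f,e\star_i u)$ with $f:u\to u'$ in $S^{\ast(1)}$ and $e:v\to v'$ in $E^{\top(1)}$, for some $0\le i\le n-2$. Write $(f,e,g)\sqsubseteq(C[f],C[e],C[g])$ for every composable whisker $C$. A branching is *critical* if it is overlapping and minimal for $\sqsubseteq$ among local branchings. $S$ is *locally $\Gamma$-confluent modulo $E$* if every local branching modulo $E$ is $\Gamma$-confluent modulo $E$. **Theorem (coherent critical branching lemma modulo).** Let $(R,E,S)$ be an $n$-polygraph modulo such that ${}_ER_E$ is terminating, and let $\Gamma$ be a square extension of $(E^\top,S^\ast)$. Then $S$ is locally $\Gamma$-confluent modulo $E$ if and only if the following two conditions hold: - $\mathbf{a_0)}$ every critical branching $(f,g)$ with $f\in S^{\ast(1)}$ and $g\in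 R^{\ast(1)}$ is $\Gamma$-confluent modulo $E$; - $\mathbf{b_0)}$ every critical branching $(f,e)$ modulo $E$ with $f\in S^{\ast(1)}$ and $e\in E^{\top(1)}$ is $\Gamma$-confluent modulo $E$. -/

import Mathlib

universe u

/-! ### Strict `n`-categories -/

/-- A strict globular `n`-category, presented with one set of cells. A `k`-cell with `k < n` is
identified with its identity `n`-cell, so the elements of `Cell` are the `n`-cells, and the
`k`-cells are the elements fixed by `src k`. For `i < n`, `src i` and `tgt i` are the `i`-source
and the `i`-target, and `comp i x y` is the composite `x ⋆ᵢ y`, meaningful when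
`tgt i x = src i y`. Values of the operations at an index `i ≥ n`, and of `comp i` at pairs that
are not `i`-composable, carry no meaning. -/
structure StrictNCat (n : ℕ) where
  Cell : Type u
  src : ℕ → Cell → Cell
  tgt : ℕ → Cell → Cell
  comp : ℕ → Cell → Cell → Cell
  src_src_le : ∀ {i j : ℕ}, i ≤ j → j < n → ∀ x, src j (src i x) = src i x
  tgt_src_le : ∀ {i j : ℕ}, i ≤ j → j < n → ∀ x, tgt j (src i x) = src i x
  src_tgt_le : ∀ {i j : ℕ}, i ≤ j → j < n → ∀ x, src j (tgt i x) = tgt i x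
  tgt_tgt_le : ∀ {i j : ℕ}, i ≤ j → j < n → ∀ x, tgt j (tgt i x) = tgt i x
  src_src_lt : ∀ {i j : ℕ}, i < j → j < n → ∀ x, src i (src j x) = src i x
  src_tgt_lt : ∀ {i j : ℕ}, i < j → j < n → ∀ x, src i (tgt j x) = src i x
  tgt_src_lt : ∀ {i j : ℕ}, i < j → j < n → ∀ x, tgt i (src j x) = tgt i x
  tgt_tgt_lt : ∀ {i j : ℕ}, i < j → j < n → ∀ x, tgt i (tgt j x) = tgt i x
  src_comp : ∀ {i : ℕ}, i < n → ∀ x y, tgt i x = src i y → src i (comp i x y) = src i x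
  tgt_comp : ∀ {i : ℕ}, i < n → ∀ x y, tgt i x = src i y → tgt i (comp i x y) = tgt i y
  src_comp_lt : ∀ {i j : ℕ}, i < j → j < n → ∀ x y, tgt i x = src i y →
    src j (comp i x y) = comp i (src j x) (src j y)
  tgt_comp_lt : ∀ {i j : ℕ}, i < j → j < n → ∀ x y, tgt i x = src i y →
    tgt j (comp i x y) = comp i (tgt j x) (tgt j y)
  src_unit : ∀ {i : ℕ}, i < n → ∀ x, comp i (src i x) x = x
  tgt_unit : ∀ {i : ℕ}, i < n → ∀ x, comp i x (tgt i x) = x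
  assoc : ∀ {i : ℕ}, i < n → ∀ x y z, tgt i x = src i y → tgt i y = src i z →
    comp i (comp i x y) z = comp i x (comp i y z)
  interchange : ∀ {i j : ℕ}, i < j → j < n → ∀ x x' y y',
    tgt j x = src j x' → tgt j y = src j y' → tgt i x = src i y → tgt i x' = src i y' →
    comp i (comp j x x') (comp j y y') = comp j (comp i x y) (comp i x' y')

/-- A set, seen as a strict `0`-category. -/
def StrictNCat.discrete (X : Type u) : StrictNCat.{u} 0 where
  Cell := X
  src _ x := x
  tgt _ x := x
  comp _ x _ := x
  src_src_le _ h := absurd h (Nat.not_lt_zero _)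
  tgt_src_le _ h := absurd h (Nat.not_lt_zero _)
  src_tgt_le _ h := absurd h (Nat.not_lt_zero _)
  tgt_tgt_le _ h := absurd h (Nat.not_lt_zero _)
  src_src_lt _ h := absurd h (Nat.not_lt_zero _)
  src_tgt_lt _ h := absurd h (Nat.not_lt_zero _)
  tgt_src_lt _ h := absurd h (Nat.not_lt_zero _)
  tgt_tgt_lt _ h := absurd h (Nat.not_lt_zero _)
  src_comp h := absurd h (Nat.not_lt_zero _)
  tgt_comp h := absurd h (Nat.not_lt_zero _)
  src_comp_lt _ h := absurd h (Nat.not_lt_zero _)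
  tgt_comp_lt _ h := absurd h (Nat.not_lt_zero _)
  src_unit h := absurd h (Nat.not_lt_zero _)
  tgt_unit h := absurd h (Nat.not_lt_zero _)
  assoc h := absurd h (Nat.not_lt_zero _)
  interchange _ h := absurd h (Nat.not_lt_zero _)

/-! ### Cellular extensions and the free `(m+1)`-category over an `m`-category -/

/-- A cellular extension of an `m`-category: a set of generating `(m+1)`-cells whose source and
target are parallel `m`-cells. -/
structure CellExt {m : ℕ} (C : StrictNCat.{u} m) where
  Gen : Type u
  s : Gen → C.Cell
  t : Gen → C.Cell
  src_eq : ∀ γ, ∀ i < m, C.src i (s γ) = C.src i (t γ)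
  tgt_eq : ∀ γ, ∀ i < m, C.tgt i (s γ) = C.tgt i (t γ)

/-- Formal composites of generating cells of `Γ` and cells of `C`, indexed by their source and
target `m`-cells; `top` is the composition `⋆ₘ`, and `comp i` with `i < m` is `⋆ᵢ`. -/
inductive CellExpr {m : ℕ} (C : StrictNCat.{u} m) (Γ : CellExt C) : C.Cell → C.Cell → Type u
  | base (c : C.Cell) : CellExpr C Γ c c
  | gen (γ : Γ.Gen) : CellExpr C Γ (Γ.s γ) (Γ.t γ)
  | top {a b b' c : C.Cell} (x : CellExpr C Γ a b) (y : CellExpr C Γ b' c) (h : b = b') :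
      CellExpr C Γ a c
  | comp {a b a' b' : C.Cell} (i : ℕ) (hi : i < m) (x : CellExpr C Γ a b)
      (y : CellExpr C Γ a' b') (h : C.tgt i a = C.src i a') :
      CellExpr C Γ (C.comp i a a') (C.comp i b b')

/-- The congruence on formal composites generated by the axioms of `(m+1)`-categories, by the
compositions of `C`, and by `γ ⋆ₘ δ = 1` for all generators with `I γ δ`. -/
inductive CellRel {m : ℕ} (C : StrictNCat.{u} m) (Γ : CellExt C) (I : Γ.Gen → Γ.Gen → Prop) :
    ∀ {a b a' b' : C.Cell}, CellExpr C Γ a b → CellExpr C Γ a' b' → Prop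
  | refl {a b} (x : CellExpr C Γ a b) : CellRel C Γ I x x
  | symm {a b a' b'} {x : CellExpr C Γ a b} {y : CellExpr C Γ a' b'} :
      CellRel C Γ I x y → CellRel C Γ I y x
  | trans {a b a' b' a'' b''} {x : CellExpr C Γ a b} {y : CellExpr C Γ a' b'}
      {z : CellExpr C Γ a'' b''} :
      CellRel C Γ I x y → CellRel C Γ I y z → CellRel C Γ I x z
  | top_congr {a b c d a' b' c' d'} {x : CellExpr C Γ a b} {x' : CellExpr C Γ a' b'}
      {y : CellExpr C Γ c d} {y' : CellExpr C Γ c' d'} (h : b = c) (h' : b' = c') :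
      CellRel C Γ I x x' → CellRel C Γ I y y' →
      CellRel C Γ I (CellExpr.top x y h) (CellExpr.top x' y' h')
  | comp_congr {a b c d a' b' c' d'} {x : CellExpr C Γ a b} {x' : CellExpr C Γ a' b'}
      {y : CellExpr C Γ c d} {y' : CellExpr C Γ c' d'} (i : ℕ) (hi : i < m)
      (h : C.tgt i a = C.src i c) (h' : C.tgt i a' = C.src i c') :
      CellRel C Γ I x x' → CellRel C Γ I y y' →
      CellRel C Γ I (CellExpr.comp i hi x y h) (CellExpr.comp i hi x' y' h')
  | top_unit_left {a b c} (x : CellExpr C Γ a b) (h : c = a) :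
      CellRel C Γ I (CellExpr.top (CellExpr.base c) x h) x
  | top_unit_right {a b c} (x : CellExpr C Γ a b) (h : b = c) :
      CellRel C Γ I (CellExpr.top x (CellExpr.base c) h) x
  | top_assoc {a b b' c c' d} (x : CellExpr C Γ a b) (y : CellExpr C Γ b' c)
      (z : CellExpr C Γ c' d) (h : b = b') (h' : c = c') :
      CellRel C Γ I (CellExpr.top (CellExpr.top x y h) z h')
        (CellExpr.top x (CellExpr.top y z h') h)
  | comp_base (a c : C.Cell) (i : ℕ) (hi : i < m) (h : C.tgt i a = C.src i c) :
      CellRel C Γ I (CellExpr.comp i hi (CellExpr.base a) (CellExpr.base c) h)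
        (CellExpr.base (C.comp i a c))
  | comp_unit_left {a b} (x : CellExpr C Γ a b) (i : ℕ) (hi : i < m)
      (h : C.tgt i (C.src i a) = C.src i a) :
      CellRel C Γ I (CellExpr.comp i hi (CellExpr.base (C.src i a)) x h) x
  | comp_unit_right {a b} (x : CellExpr C Γ a b) (i : ℕ) (hi : i < m)
      (h : C.tgt i a = C.src i (C.tgt i a)) :
      CellRel C Γ I (CellExpr.comp i hi x (CellExpr.base (C.tgt i a)) h) x
  | comp_assoc {a b a' b' a'' b''} (x : CellExpr C Γ a b) (y : CellExpr C Γ a' b')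
      (z : CellExpr C Γ a'' b'') (i : ℕ) (hi : i < m) (h₁ : C.tgt i a = C.src i a')
      (h₂ : C.tgt i a' = C.src i a'') (h₃ : C.tgt i (C.comp i a a') = C.src i a'')
      (h₄ : C.tgt i a = C.src i (C.comp i a' a'')) :
      CellRel C Γ I (CellExpr.comp i hi (CellExpr.comp i hi x y h₁) z h₃)
        (CellExpr.comp i hi x (CellExpr.comp i hi y z h₂) h₄)
  | comp_interchange {a b a' b' c d c' d'} (x : CellExpr C Γ a b) (x' : CellExpr C Γ a' b')
      (y : CellExpr C Γ c d) (y' : CellExpr C Γ c' d') (i j : ℕ) (hij : i < j) (hi : i < m)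
      (hj : j < m) (h₁ : C.tgt j a = C.src j a') (h₂ : C.tgt j c = C.src j c')
      (h₃ : C.tgt i a = C.src i c) (h₄ : C.tgt i a' = C.src i c')
      (h₅ : C.tgt i (C.comp j a a') = C.src i (C.comp j c c'))
      (h₆ : C.tgt j (C.comp i a c) = C.src j (C.comp i a' c')) :
      CellRel C Γ I
        (CellExpr.comp i hi (CellExpr.comp j hj x x' h₁) (CellExpr.comp j hj y y' h₂) h₅)
        (CellExpr.comp j hj (CellExpr.comp i hi x y h₃) (CellExpr.comp i hi x' y' h₄) h₆)
  | top_interchange {a b b' e c d d' f} (x : CellExpr C Γ a b) (x' : CellExpr C Γ b' e)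
      (y : CellExpr C Γ c d) (y' : CellExpr C Γ d' f) (i : ℕ) (hi : i < m)
      (h₁ : b = b') (h₂ : d = d') (h₃ : C.tgt i a = C.src i c) (h₄ : C.tgt i b' = C.src i d')
      (h₅ : C.comp i b d = C.comp i b' d') :
      CellRel C Γ I (CellExpr.comp i hi (CellExpr.top x x' h₁) (CellExpr.top y y' h₂) h₃)
        (CellExpr.top (CellExpr.comp i hi x y h₃) (CellExpr.comp i hi x' y' h₄) h₅)
  | inverse (γ δ : Γ.Gen) (h : Γ.t γ = Γ.s δ) (h' : Γ.t δ = Γ.s γ) : I γ δ →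
      CellRel C Γ I (CellExpr.top (CellExpr.gen γ) (CellExpr.gen δ) h)
        (CellExpr.base (Γ.s γ))

namespace CellExpr

variable {m : ℕ} {C : StrictNCat.{u} m} {Γ : CellExt C} {I : Γ.Gen → Γ.Gen → Prop}

theorem parallel {a b : C.Cell} (x : CellExpr C Γ a b) :
    ∀ i < m, C.src i a = C.src i b ∧ C.tgt i a = C.tgt i b := by
  induction x with
  | base c => exact fun i _ => ⟨rfl, rfl⟩
  | gen γ => exact fun i hi => ⟨Γ.src_eq γ i hi, Γ.tgt_eq γ i hi⟩
  | top x y h ihx ihy =>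
    subst h
    exact fun i hi => ⟨(ihx i hi).1.trans (ihy i hi).1, (ihx i hi).2.trans (ihy i hi).2⟩
  | @comp a b a' b' j hj x y h ihx ihy =>
    have h' : C.tgt j b = C.src j b' := by rw [← (ihx j hj).2, ← (ihy j hj).1, h]
    intro i hi
    rcases lt_trichotomy i j with hij | rfl | hij
    · rw [← C.src_src_lt hij hj (C.comp j a a'), ← C.src_src_lt hij hj (C.comp j b b'),
        ← C.tgt_src_lt hij hj (C.comp j a a'), ← C.tgt_src_lt hij hj (C.comp j b b'),
        C.src_comp hj _ _ h, C.src_comp hj _ _ h', (ihx j hj).1]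
      exact ⟨rfl, rfl⟩
    · rw [C.src_comp hj _ _ h, C.src_comp hj _ _ h', C.tgt_comp hj _ _ h, C.tgt_comp hj _ _ h']
      exact ⟨(ihx i hi).1, (ihy i hi).2⟩
    · rw [C.src_comp_lt hij hi _ _ h, C.src_comp_lt hij hi _ _ h', C.tgt_comp_lt hij hi _ _ h,
        C.tgt_comp_lt hij hi _ _ h', (ihx i hi).1, (ihx i hi).2, (ihy i hi).1, (ihy i hi).2]
      exact ⟨rfl, rfl⟩

theorem composable {a b a' b' : C.Cell} (x : CellExpr C Γ a b) (y : CellExpr C Γ a' b') {i : ℕ}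
    (hi : i < m) : C.tgt i a = C.src i a' ↔ C.tgt i b = C.src i b' := by
  rw [(x.parallel i hi).2, (y.parallel i hi).1]

end CellExpr

theorem CellRel.ends {m : ℕ} {C : StrictNCat.{u} m} {Γ : CellExt C}
    {I : Γ.Gen → Γ.Gen → Prop} {a b a' b' : C.Cell} {x : CellExpr C Γ a b}
    {y : CellExpr C Γ a' b'} (h : CellRel C Γ I x y) : a = a' ∧ b = b' := by
  induction h with
  | refl x => exact ⟨rfl, rfl⟩
  | symm _ ih => exact ⟨ih.1.symm, ih.2.symm⟩
  | trans _ _ ih ih' => exact ⟨ih.1.trans ih'.1, ih.2.trans ih'.2⟩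
  | top_congr h h' _ _ ih ih' => exact ⟨ih.1, ih'.2⟩
  | comp_congr i hi h h' _ _ ih ih' =>
    rw [ih.1, ih.2, ih'.1, ih'.2]
    exact ⟨rfl, rfl⟩
  | top_unit_left x h => exact ⟨h, rfl⟩
  | top_unit_right x h => exact ⟨rfl, h.symm⟩
  | top_assoc => exact ⟨rfl, rfl⟩
  | comp_base => exact ⟨rfl, rfl⟩
  | comp_unit_left x i hi h =>
    exact ⟨C.src_unit hi _, by rw [(x.parallel i hi).1, C.src_unit hi]⟩
  | comp_unit_right x i hi h =>
    exact ⟨C.tgt_unit hi _, by rw [(x.parallel i hi).2, C.tgt_unit hi]⟩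
  | comp_assoc x y z i hi h₁ h₂ h₃ h₄ =>
    exact ⟨C.assoc hi _ _ _ h₁ h₂,
      C.assoc hi _ _ _ ((x.composable y hi).1 h₁) ((y.composable z hi).1 h₂)⟩
  | comp_interchange x x' y y' i j hij hi hj h₁ h₂ h₃ h₄ h₅ h₆ =>
    exact ⟨C.interchange hij hj _ _ _ _ h₁ h₂ h₃ h₄,
      C.interchange hij hj _ _ _ _ ((x.composable x' hj).1 h₁) ((y.composable y' hj).1 h₂)
        ((x.composable y hi).1 h₃) ((x'.composable y' hi).1 h₄)⟩
  | top_interchange => exact ⟨rfl, rfl⟩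
  | inverse γ δ h h' _ => exact ⟨rfl, h'⟩

/-- A formal composite together with its source and target. -/
structure CellTerm {m : ℕ} (C : StrictNCat.{u} m) (Γ : CellExt C) where
  dom : C.Cell
  cod : C.Cell
  expr : CellExpr C Γ dom cod

namespace FreeExt

variable {m : ℕ} (C : StrictNCat.{u} m) (Γ : CellExt C) (I : Γ.Gen → Γ.Gen → Prop)

def setoid : Setoid (CellTerm C Γ) where
  r x y := CellRel C Γ I x.expr y.expr
  iseqv := ⟨fun x => CellRel.refl x.expr, fun h => CellRel.symm h,
    fun h h' => CellRel.trans h h'⟩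

/-- The `(m+1)`-cells. -/
def Cells : Type u := Quotient (setoid C Γ I)

variable {C Γ}

/-- The class of a formal composite. -/
def mk {a b : C.Cell} (x : CellExpr C Γ a b) : Cells C Γ I :=
  Quotient.mk (setoid C Γ I) ⟨a, b, x⟩

/-- The identity `(m+1)`-cell of an `m`-cell. -/
def unit (c : C.Cell) : Cells C Γ I := mk I (CellExpr.base c)

/-- A generating cell as an `(m+1)`-cell. -/
def gen (γ : Γ.Gen) : Cells C Γ I := mk I (CellExpr.gen γ)

variable {I}

/-- The `m`-source, in `C`. -/
def dom (x : Cells C Γ I) : C.Cell :=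
  Quotient.lift (s := setoid C Γ I) CellTerm.dom (fun _ _ h => (CellRel.ends h).1) x

/-- The `m`-target, in `C`. -/
def cod (x : Cells C Γ I) : C.Cell :=
  Quotient.lift (s := setoid C Γ I) CellTerm.cod (fun _ _ h => (CellRel.ends h).2) x

theorem mk_eq {a b a' b' : C.Cell} {x : CellExpr C Γ a b} {y : CellExpr C Γ a' b'}
    (h : CellRel C Γ I x y) : mk I x = mk I y :=
  Quotient.sound (s := setoid C Γ I) h

theorem ind {p : Cells C Γ I → Prop}
    (h : ∀ (a b : C.Cell) (x : CellExpr C Γ a b), p (mk I x)) (x : Cells C Γ I) : p x :=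
  Quotient.ind (s := setoid C Γ I) (fun t => h t.dom t.cod t.expr) x

open Classical in
/-- Composition `⋆ᵢ` of formal composites. -/
noncomputable def compTerm (i : ℕ) (x y : CellTerm C Γ) : CellTerm C Γ :=
  if h : i < m ∧ C.tgt i x.dom = C.src i y.dom then
    ⟨_, _, CellExpr.comp i h.1 x.expr y.expr h.2⟩
  else if h : i = m ∧ x.cod = y.dom then ⟨_, _, CellExpr.top x.expr y.expr h.2⟩
  else x

theorem compTerm_lt {i : ℕ} {x y : CellTerm C Γ} (h : i < m ∧ C.tgt i x.dom = C.src i y.dom) :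
    compTerm i x y = ⟨_, _, CellExpr.comp i h.1 x.expr y.expr h.2⟩ := dif_pos h

theorem compTerm_top {i : ℕ} {x y : CellTerm C Γ} (h : i = m ∧ x.cod = y.dom) :
    compTerm i x y = ⟨_, _, CellExpr.top x.expr y.expr h.2⟩ := by
  unfold compTerm
  rw [dif_neg (fun h' => absurd h.1 (Nat.ne_of_lt h'.1)), dif_pos h]

theorem compTerm_of_not {i : ℕ} {x y : CellTerm C Γ}
    (h : ¬ (i < m ∧ C.tgt i x.dom = C.src i y.dom)) (h' : ¬ (i = m ∧ x.cod = y.dom)) :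
    compTerm i x y = x := by
  unfold compTerm
  rw [dif_neg h, dif_neg h']

theorem compTerm_congr (i : ℕ) {x x' y y' : CellTerm C Γ} (hx : CellRel C Γ I x.expr x'.expr)
    (hy : CellRel C Γ I y.expr y'.expr) :
    CellRel C Γ I (compTerm i x y).expr (compTerm i x' y').expr := by
  obtain ⟨h₁, h₂⟩ := hx.ends
  obtain ⟨h₃, h₄⟩ := hy.ends
  by_cases h : i < m ∧ C.tgt i x.dom = C.src i y.dom
  · have h' : i < m ∧ C.tgt i x'.dom = C.src i y'.dom := by rwa [← h₁, ← h₃]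
    rw [compTerm_lt h, compTerm_lt h']
    exact CellRel.comp_congr i h.1 _ _ hx hy
  · have h' : ¬ (i < m ∧ C.tgt i x'.dom = C.src i y'.dom) := by rwa [← h₁, ← h₃]
    by_cases k : i = m ∧ x.cod = y.dom
    · have k' : i = m ∧ x'.cod = y'.dom := by rwa [← h₂, ← h₃]
      rw [compTerm_top k, compTerm_top k']
      exact CellRel.top_congr _ _ hx hy
    · have k' : ¬ (i = m ∧ x'.cod = y'.dom) := by rwa [← h₂, ← h₃]
      rw [compTerm_of_not h k, compTerm_of_not h' k']
      exact hx

/-- Composition `⋆ᵢ`, for `i ≤ m`. -/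
noncomputable def comp (i : ℕ) (x y : Cells C Γ I) : Cells C Γ I :=
  Quotient.map₂ (sa := setoid C Γ I) (sb := setoid C Γ I) (sc := setoid C Γ I) (compTerm i)
    (fun _ _ hx _ _ hy => compTerm_congr i hx hy) x y

/-- The `i`-source, for `i ≤ m`. -/
def src (i : ℕ) (x : Cells C Γ I) : Cells C Γ I :=
  unit I (if i < m then C.src i (dom x) else dom x)

/-- The `i`-target, for `i ≤ m`. -/
def tgt (i : ℕ) (x : Cells C Γ I) : Cells C Γ I :=
  unit I (if i < m then C.tgt i (cod x) else cod x)

theorem dom_mk {a b : C.Cell} (x : CellExpr C Γ a b) : dom (mk I x) = a := rfl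

theorem cod_mk {a b : C.Cell} (x : CellExpr C Γ a b) : cod (mk I x) = b := rfl

theorem dom_unit (c : C.Cell) : dom (unit (Γ := Γ) I c) = c := rfl

theorem cod_unit (c : C.Cell) : cod (unit (Γ := Γ) I c) = c := rfl

theorem unit_inj {c d : C.Cell} (h : unit (Γ := Γ) I c = unit I d) : c = d := congrArg dom h

theorem src_lt {i : ℕ} (hi : i < m) (x : Cells C Γ I) : src i x = unit I (C.src i (dom x)) := by
  simp [src, hi]

theorem tgt_lt {i : ℕ} (hi : i < m) (x : Cells C Γ I) : tgt i x = unit I (C.tgt i (cod x)) := by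
  simp [tgt, hi]

theorem src_top (x : Cells C Γ I) : src m x = unit I (dom x) := by simp [src]

theorem tgt_top (x : Cells C Γ I) : tgt m x = unit I (cod x) := by simp [tgt]

theorem src_dom_cod {i : ℕ} (hi : i < m) (x : Cells C Γ I) :
    C.src i (cod x) = C.src i (dom x) := by
  induction x using ind with
  | h a b x => exact (x.parallel i hi).1.symm

theorem tgt_dom_cod {i : ℕ} (hi : i < m) (x : Cells C Γ I) :
    C.tgt i (cod x) = C.tgt i (dom x) := by
  induction x using ind with
  | h a b x => exact (x.parallel i hi).2.symm

theorem comp_mk_lt {i : ℕ} (hi : i < m) {a b a' b' : C.Cell} (x : CellExpr C Γ a b)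
    (y : CellExpr C Γ a' b') (h : C.tgt i a = C.src i a') :
    comp i (mk I x) (mk I y) = mk I (CellExpr.comp i hi x y h) :=
  congrArg (Quotient.mk (setoid C Γ I))
    (compTerm_lt (x := ⟨a, b, x⟩) (y := ⟨a', b', y⟩) ⟨hi, h⟩)

theorem comp_mk_top {a b a' b' : C.Cell} (x : CellExpr C Γ a b)
    (y : CellExpr C Γ a' b') (h : b = a') :
    comp m (mk I x) (mk I y) = mk I (CellExpr.top x y h) :=
  congrArg (Quotient.mk (setoid C Γ I))
    (compTerm_top (x := ⟨a, b, x⟩) (y := ⟨a', b', y⟩) ⟨rfl, h⟩)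

/-- Composability of `(m+1)`-cells, below the top dimension. -/
theorem composable_lt {i : ℕ} (hi : i < m) {x y : Cells C Γ I} (h : tgt i x = src i y) :
    C.tgt i (dom x) = C.src i (dom y) := by
  rw [tgt_lt hi, src_lt hi] at h
  rw [← tgt_dom_cod hi]
  exact unit_inj h

theorem composable_top {x y : Cells C Γ I} (h : tgt m x = src m y) : cod x = dom y := by
  rw [tgt_top, src_top] at h
  exact unit_inj h

theorem dom_comp_lt {i : ℕ} (hi : i < m) {x y : Cells C Γ I}
    (h : C.tgt i (dom x) = C.src i (dom y)) :
    dom (comp i x y) = C.comp i (dom x) (dom y) ∧ cod (comp i x y) = C.comp i (cod x) (cod y) := by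
  induction x using ind with
  | h a b x =>
    induction y using ind with
    | h c d y =>
      rw [comp_mk_lt hi x y h]
      exact ⟨rfl, rfl⟩

theorem dom_comp_top {x y : Cells C Γ I} (h : cod x = dom y) :
    dom (comp m x y) = dom x ∧ cod (comp m x y) = cod y := by
  induction x using ind with
  | h a b x =>
    induction y using ind with
    | h c d y =>
      rw [comp_mk_top x y h]
      exact ⟨rfl, rfl⟩

theorem unit_comp {i : ℕ} (hi : i < m) {a b : C.Cell} (h : C.tgt i a = C.src i b) :
    comp i (unit (Γ := Γ) I a) (unit I b) = unit I (C.comp i a b) :=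
  (comp_mk_lt hi (CellExpr.base a) (CellExpr.base b) h).trans
    (mk_eq (CellRel.comp_base a b i hi h))

end FreeExt

namespace FreeExt

variable {m : ℕ} (C : StrictNCat.{u} m) (Γ : CellExt C) (I : Γ.Gen → Γ.Gen → Prop)

/-- The `(m+1)`-category freely generated by `Γ` over the `m`-category `C`, subject to the
relations `γ ⋆ₘ δ = 1` for `I γ δ`. -/
noncomputable def cat : StrictNCat.{u} (m + 1) where
  Cell := Cells C Γ I
  src := src
  tgt := tgt
  comp := comp
  src_src_le {i j} hij hj x := by
    rcases Nat.lt_succ_iff_lt_or_eq.1 hj with hj | rfl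
    · rw [src_lt hj, src_lt (hij.trans_lt hj), dom_unit, C.src_src_le hij hj]
    · rw [src_top]; rfl
  tgt_src_le {i j} hij hj x := by
    rcases Nat.lt_succ_iff_lt_or_eq.1 hj with hj | rfl
    · rw [tgt_lt hj, src_lt (hij.trans_lt hj), cod_unit, C.tgt_src_le hij hj]
    · rw [tgt_top]; rfl
  src_tgt_le {i j} hij hj x := by
    rcases Nat.lt_succ_iff_lt_or_eq.1 hj with hj | rfl
    · rw [src_lt hj, tgt_lt (hij.trans_lt hj), dom_unit, C.src_tgt_le hij hj]
    · rw [src_top]; rfl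
  tgt_tgt_le {i j} hij hj x := by
    rcases Nat.lt_succ_iff_lt_or_eq.1 hj with hj | rfl
    · rw [tgt_lt hj, tgt_lt (hij.trans_lt hj), cod_unit, C.tgt_tgt_le hij hj]
    · rw [tgt_top]; rfl
  src_src_lt {i j} hij hj x := by
    rcases Nat.lt_succ_iff_lt_or_eq.1 hj with hj | rfl
    · rw [src_lt hj, src_lt (hij.trans hj), src_lt (hij.trans hj), dom_unit, C.src_src_lt hij hj]
    · rw [src_top, src_lt hij, src_lt hij, dom_unit]
  src_tgt_lt {i j} hij hj x := by
    rcases Nat.lt_succ_iff_lt_or_eq.1 hj with hj | rfl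
    · rw [tgt_lt hj, src_lt (hij.trans hj), src_lt (hij.trans hj), dom_unit, C.src_tgt_lt hij hj,
        src_dom_cod (hij.trans hj)]
    · rw [tgt_top, src_lt hij, src_lt hij, dom_unit, src_dom_cod hij]
  tgt_src_lt {i j} hij hj x := by
    rcases Nat.lt_succ_iff_lt_or_eq.1 hj with hj | rfl
    · rw [src_lt hj, tgt_lt (hij.trans hj), tgt_lt (hij.trans hj), cod_unit, C.tgt_src_lt hij hj,
        tgt_dom_cod (hij.trans hj)]
    · rw [src_top, tgt_lt hij, tgt_lt hij, cod_unit, tgt_dom_cod hij]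
  tgt_tgt_lt {i j} hij hj x := by
    rcases Nat.lt_succ_iff_lt_or_eq.1 hj with hj | rfl
    · rw [tgt_lt hj, tgt_lt (hij.trans hj), tgt_lt (hij.trans hj), cod_unit, C.tgt_tgt_lt hij hj]
    · rw [tgt_top, tgt_lt hij, tgt_lt hij, cod_unit]
  src_comp {i} hi x y h := by
    rcases Nat.lt_succ_iff_lt_or_eq.1 hi with hi | rfl
    · have h' := composable_lt hi h
      rw [src_lt hi, src_lt hi, (dom_comp_lt hi h').1, C.src_comp hi _ _ h']
    · rw [src_top, src_top, (dom_comp_top (composable_top h)).1]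
  tgt_comp {i} hi x y h := by
    rcases Nat.lt_succ_iff_lt_or_eq.1 hi with hi | rfl
    · have h' := composable_lt hi h
      rw [tgt_lt hi, tgt_lt hi, (dom_comp_lt hi h').2, C.tgt_comp hi _ _
        (by rw [tgt_dom_cod hi, src_dom_cod hi, h'])]
    · rw [tgt_top, tgt_top, (dom_comp_top (composable_top h)).2]
  src_comp_lt {i j} hij hj x y h := by
    rcases Nat.lt_succ_iff_lt_or_eq.1 hj with hj | rfl
    · have hi := hij.trans hj
      have h' := composable_lt hi h
      rw [src_lt hj, src_lt hj, src_lt hj, (dom_comp_lt hi h').1, C.src_comp_lt hij hj _ _ h',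
        unit_comp hi (by rw [C.tgt_src_lt hij hj, C.src_src_lt hij hj, h'])]
    · have h' := composable_lt hij h
      rw [src_top, src_top, src_top, (dom_comp_lt hij h').1, unit_comp hij h']
  tgt_comp_lt {i j} hij hj x y h := by
    rcases Nat.lt_succ_iff_lt_or_eq.1 hj with hj | rfl
    · have hi := hij.trans hj
      have h' := composable_lt hi h
      have h'' : C.tgt i (cod x) = C.src i (cod y) := by
        rw [tgt_dom_cod hi, src_dom_cod hi, h']
      rw [tgt_lt hj, tgt_lt hj, tgt_lt hj, (dom_comp_lt hi h').2, C.tgt_comp_lt hij hj _ _ h'',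
        unit_comp hi (by rw [C.tgt_tgt_lt hij hj, C.src_tgt_lt hij hj, h''])]
    · have h' := composable_lt hij h
      have h'' : C.tgt i (cod x) = C.src i (cod y) := by
        rw [tgt_dom_cod hij, src_dom_cod hij, h']
      rw [tgt_top, tgt_top, tgt_top, (dom_comp_lt hij h').2, unit_comp hij h'']
  src_unit {i} hi x := by
    rcases Nat.lt_succ_iff_lt_or_eq.1 hi with hi | rfl
    · rw [src_lt hi]
      induction x using ind with
      | h a b x =>
        exact (comp_mk_lt hi (CellExpr.base _) x (C.tgt_src_le le_rfl hi a)).trans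
          (mk_eq (CellRel.comp_unit_left x i hi _))
    · rw [src_top]
      induction x using ind with
      | h a b x =>
        exact (comp_mk_top (CellExpr.base _) x rfl).trans (mk_eq (CellRel.top_unit_left x _))
  tgt_unit {i} hi x := by
    rcases Nat.lt_succ_iff_lt_or_eq.1 hi with hi | rfl
    · rw [tgt_lt hi, tgt_dom_cod hi]
      induction x using ind with
      | h a b x =>
        exact (comp_mk_lt hi x (CellExpr.base _) (C.src_tgt_le le_rfl hi a).symm).trans
          (mk_eq (CellRel.comp_unit_right x i hi _))
    · rw [tgt_top]
      induction x using ind with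
      | h a b x =>
        exact (comp_mk_top x (CellExpr.base _) rfl).trans (mk_eq (CellRel.top_unit_right x _))
  assoc {i} hi x y z h h' := by
    induction x using ind with
    | h a b x =>
    induction y using ind with
    | h a' b' y =>
    induction z using ind with
    | h a'' b'' z =>
    rcases Nat.lt_succ_iff_lt_or_eq.1 hi with hi | rfl
    · have k : C.tgt i a = C.src i a' := composable_lt hi h
      have k' : C.tgt i a' = C.src i a'' := composable_lt hi h'
      have k₁ : C.tgt i (C.comp i a a') = C.src i a'' := by rw [C.tgt_comp hi _ _ k, k']
      have k₂ : C.tgt i a = C.src i (C.comp i a' a'') := by rw [C.src_comp hi _ _ k', k]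
      rw [comp_mk_lt hi x y k, comp_mk_lt hi y z k', comp_mk_lt hi _ z k₁, comp_mk_lt hi x _ k₂]
      exact mk_eq (CellRel.comp_assoc x y z i hi k k' k₁ k₂)
    · have k : b = a' := composable_top h
      have k' : b' = a'' := composable_top h'
      rw [comp_mk_top x y k, comp_mk_top y z k', comp_mk_top _ z k', comp_mk_top x _ k]
      exact mk_eq (CellRel.top_assoc x y z k k')
  interchange {i j} hij hj x x' y y' h₁ h₂ h₃ h₄ := by
    induction x using ind with
    | h a b x =>
    induction x' using ind with
    | h a' b' x' =>
    induction y using ind with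
    | h c d y =>
    induction y' using ind with
    | h c' d' y' =>
    rcases Nat.lt_succ_iff_lt_or_eq.1 hj with hj | rfl
    · have hi := hij.trans hj
      have k₁ : C.tgt j a = C.src j a' := composable_lt hj h₁
      have k₂ : C.tgt j c = C.src j c' := composable_lt hj h₂
      have k₃ : C.tgt i a = C.src i c := composable_lt hi h₃
      have k₄ : C.tgt i a' = C.src i c' := composable_lt hi h₄
      have k₅ : C.tgt i (C.comp j a a') = C.src i (C.comp j c c') := by
        rw [← C.tgt_src_lt hij hj, ← C.src_src_lt hij hj, C.src_comp hj _ _ k₁,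
          C.src_comp hj _ _ k₂, C.tgt_src_lt hij hj, C.src_src_lt hij hj, k₃]
      have k₆ : C.tgt j (C.comp i a c) = C.src j (C.comp i a' c') := by
        rw [C.tgt_comp_lt hij hj _ _ k₃, C.src_comp_lt hij hj _ _ k₄, k₁, k₂]
      rw [comp_mk_lt hj x x' k₁, comp_mk_lt hj y y' k₂, comp_mk_lt hi x y k₃,
        comp_mk_lt hi x' y' k₄, comp_mk_lt hi _ _ k₅, comp_mk_lt hj _ _ k₆]
      exact mk_eq (CellRel.comp_interchange x x' y y' i j hij hi hj k₁ k₂ k₃ k₄ k₅ k₆)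
    · have k₁ : b = a' := composable_top h₁
      have k₂ : d = c' := composable_top h₂
      have k₃ : C.tgt i a = C.src i c := composable_lt hij h₃
      have k₄ : C.tgt i a' = C.src i c' := composable_lt hij h₄
      have k₅ : C.comp i b d = C.comp i a' c' := by rw [k₁, k₂]
      rw [comp_mk_top x x' k₁, comp_mk_top y y' k₂, comp_mk_lt hij x y k₃,
        comp_mk_lt hij x' y' k₄, comp_mk_lt hij _ _ k₃, comp_mk_top _ _ k₅]
      exact mk_eq (CellRel.top_interchange x x' y y' i hij k₁ k₂ k₃ k₄ k₅)

end FreeExt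

/-! ### Functors out of a free extension -/

namespace FreeExt

variable {m : ℕ} {C : StrictNCat.{u} m} {Γ Δ : CellExt C} {I : Γ.Gen → Γ.Gen → Prop}
  {J : Δ.Gen → Δ.Gen → Prop}

/-- Evaluation of a formal composite in the free extension by `Δ`, given values `φ` for the
generators. -/
noncomputable def eval (J : Δ.Gen → Δ.Gen → Prop) (φ : Γ.Gen → Cells C Δ J) :
    ∀ {a b : C.Cell}, CellExpr C Γ a b → Cells C Δ J
  | _, _, CellExpr.base c => unit J c
  | _, _, CellExpr.gen γ => φ γ
  | _, _, CellExpr.top x y _ => comp m (eval J φ x) (eval J φ y)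
  | _, _, CellExpr.comp i _ x y _ => comp i (eval J φ x) (eval J φ y)

theorem eval_ends (φ : Γ.Gen → Cells C Δ J)
    (hφ : ∀ γ, dom (φ γ) = Γ.s γ ∧ cod (φ γ) = Γ.t γ) {a b : C.Cell} (x : CellExpr C Γ a b) :
    dom (eval J φ x) = a ∧ cod (eval J φ x) = b := by
  induction x with
  | base c => exact ⟨rfl, rfl⟩
  | gen γ => exact hφ γ
  | top x y h ihx ihy =>
    have := dom_comp_top (x := eval J φ x) (y := eval J φ y) (by rw [ihx.2, ihy.1, h])
    exact ⟨this.1.trans ihx.1, this.2.trans ihy.2⟩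
  | comp i hi x y h ihx ihy =>
    have := dom_comp_lt (x := eval J φ x) (y := eval J φ y) hi (by rw [ihx.1, ihy.1, h])
    rw [ihx.1, ihx.2, ihy.1, ihy.2] at this
    exact this

theorem composable_of_lt {i : ℕ} (hi : i < m) {x y : Cells C Γ I}
    (h : C.tgt i (dom x) = C.src i (dom y)) : (cat C Γ I).tgt i x = (cat C Γ I).src i y := by
  change tgt i x = src i y
  rw [tgt_lt hi, src_lt hi, tgt_dom_cod hi, h]

theorem composable_of_top {x y : Cells C Γ I} (h : cod x = dom y) :
    (cat C Γ I).tgt m x = (cat C Γ I).src m y := by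
  change tgt m x = src m y
  rw [tgt_top, src_top, h]

theorem eval_rel (φ : Γ.Gen → Cells C Δ J)
    (hφ : ∀ γ, dom (φ γ) = Γ.s γ ∧ cod (φ γ) = Γ.t γ)
    (hI : ∀ γ δ, I γ δ → Γ.t γ = Γ.s δ → Γ.t δ = Γ.s γ →
      comp m (φ γ) (φ δ) = unit J (Γ.s γ))
    {a b a' b' : C.Cell} {x : CellExpr C Γ a b} {y : CellExpr C Γ a' b'}
    (h : CellRel C Γ I x y) : eval J φ x = eval J φ y := by
  have hd : ∀ {a b : C.Cell} (x : CellExpr C Γ a b), dom (eval J φ x) = a :=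
    fun x => (eval_ends φ hφ x).1
  have hc : ∀ {a b : C.Cell} (x : CellExpr C Γ a b), cod (eval J φ x) = b :=
    fun x => (eval_ends φ hφ x).2
  induction h with
  | refl x => rfl
  | symm _ ih => exact ih.symm
  | trans _ _ ih ih' => exact ih.trans ih'
  | top_congr h h' _ _ ih ih' => simp only [eval, ih, ih']
  | comp_congr i hi h h' _ _ ih ih' => simp only [eval, ih, ih']
  | top_unit_left x h =>
    subst h
    have := (cat C Δ J).src_unit (Nat.lt_succ_self m) (eval J φ x)
    change comp m (src m _) _ = _ at this
    rw [src_top, hd] at this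
    exact this
  | top_unit_right x h =>
    subst h
    have := (cat C Δ J).tgt_unit (Nat.lt_succ_self m) (eval J φ x)
    change comp m _ (tgt m _) = _ at this
    rw [tgt_top, hc] at this
    exact this
  | top_assoc x y z h h' =>
    exact (cat C Δ J).assoc (Nat.lt_succ_self m) (eval J φ x) (eval J φ y) (eval J φ z)
      (composable_of_top (by rw [hc, hd, h])) (composable_of_top (by rw [hc, hd, h']))
  | comp_base a c i hi h => exact unit_comp hi h
  | comp_unit_left x i hi h =>
    have := (cat C Δ J).src_unit (hi.trans (Nat.lt_succ_self m)) (eval J φ x)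
    change comp i (src i _) _ = _ at this
    rw [src_lt hi, hd] at this
    exact this
  | comp_unit_right x i hi h =>
    have := (cat C Δ J).tgt_unit (hi.trans (Nat.lt_succ_self m)) (eval J φ x)
    change comp i _ (tgt i _) = _ at this
    rw [tgt_lt hi, tgt_dom_cod hi, hd] at this
    exact this
  | comp_assoc x y z i hi h₁ h₂ h₃ h₄ =>
    exact (cat C Δ J).assoc (hi.trans (Nat.lt_succ_self m)) (eval J φ x) (eval J φ y)
      (eval J φ z) (composable_of_lt hi (by rw [hd, hd, h₁]))
      (composable_of_lt hi (by rw [hd, hd, h₂]))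
  | comp_interchange x x' y y' i j hij hi hj h₁ h₂ h₃ h₄ h₅ h₆ =>
    exact (cat C Δ J).interchange hij (hj.trans (Nat.lt_succ_self m)) (eval J φ x)
      (eval J φ x') (eval J φ y) (eval J φ y') (composable_of_lt hj (by rw [hd, hd, h₁]))
      (composable_of_lt hj (by rw [hd, hd, h₂])) (composable_of_lt hi (by rw [hd, hd, h₃]))
      (composable_of_lt hi (by rw [hd, hd, h₄]))
  | top_interchange x x' y y' i hi h₁ h₂ h₃ h₄ h₅ =>
    exact (cat C Δ J).interchange hi (Nat.lt_succ_self m) (eval J φ x)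
      (eval J φ x') (eval J φ y) (eval J φ y') (composable_of_top (by rw [hc, hd, h₁]))
      (composable_of_top (by rw [hc, hd, h₂])) (composable_of_lt hi (by rw [hd, hd, h₃]))
      (composable_of_lt hi (by rw [hd, hd, h₄]))
  | inverse γ δ h h' hI' => exact hI γ δ hI' h h'

/-- The functor, identical on `C`, from the free extension by `Γ` to the free extension by `Δ`
with prescribed values on the generators. -/
noncomputable def lift (φ : Γ.Gen → Cells C Δ J)
    (hφ : ∀ γ, dom (φ γ) = Γ.s γ ∧ cod (φ γ) = Γ.t γ)
    (hI : ∀ γ δ, I γ δ → Γ.t γ = Γ.s δ → Γ.t δ = Γ.s γ →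
      comp m (φ γ) (φ δ) = unit J (Γ.s γ))
    (x : Cells C Γ I) : Cells C Δ J :=
  Quotient.lift (s := setoid C Γ I) (fun t => eval J φ t.expr)
    (fun _ _ h => eval_rel φ hφ hI h) x

theorem lift_ends (φ : Γ.Gen → Cells C Δ J)
    (hφ : ∀ γ, dom (φ γ) = Γ.s γ ∧ cod (φ γ) = Γ.t γ)
    (hI : ∀ γ δ, I γ δ → Γ.t γ = Γ.s δ → Γ.t δ = Γ.s γ →
      comp m (φ γ) (φ δ) = unit J (Γ.s γ))
    (x : Cells C Γ I) : dom (lift φ hφ hI x) = dom x ∧ cod (lift φ hφ hI x) = cod x := by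
  induction x using ind with
  | h a b x => exact eval_ends φ hφ x

end FreeExt

/-! ### Polygraphs -/

/-- The free `(m+1)`-category `C[Γ]`. -/
noncomputable def CellExt.freeCat {m : ℕ} {C : StrictNCat.{u} m} (Γ : CellExt C) :
    StrictNCat.{u} (m + 1) :=
  FreeExt.cat C Γ (fun _ _ => False)

/-- The type of `n`-polygraphs together with the free `n`-category functor on objects: a
`0`-polygraph is a set, and an `(n+1)`-polygraph is an `n`-polygraph with a cellular extension of
its free `n`-category. -/
noncomputable def polygraphData : (n : ℕ) → Σ T : Type (u + 1), T → StrictNCat.{u} n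
  | 0 => ⟨Type u, StrictNCat.discrete⟩
  | n + 1 => ⟨Σ P : (polygraphData n).1, CellExt ((polygraphData n).2 P), fun P => P.2.freeCat⟩

/-- `n`-polygraphs. -/
def Polygraph (n : ℕ) : Type (u + 1) := (polygraphData.{u} n).1

/-- The free `n`-category on an `n`-polygraph. -/
noncomputable def Polygraph.free {n : ℕ} (P : Polygraph.{u} n) : StrictNCat.{u} n :=
  (polygraphData.{u} n).2 P

/-- The generators of `Γ` together with their formal inverses (the pairs with `false`). -/
def CellExt.signed {m : ℕ} {C : StrictNCat.{u} m} (Γ : CellExt C) : CellExt C where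
  Gen := Γ.Gen × Bool
  s γ := if γ.2 then Γ.s γ.1 else Γ.t γ.1
  t γ := if γ.2 then Γ.t γ.1 else Γ.s γ.1
  src_eq := by
    rintro ⟨γ, _ | _⟩ i hi
    · simpa using (Γ.src_eq γ i hi).symm
    · simpa using Γ.src_eq γ i hi
  tgt_eq := by
    rintro ⟨γ, _ | _⟩ i hi
    · simpa using (Γ.tgt_eq γ i hi).symm
    · simpa using Γ.tgt_eq γ i hi

/-- A generator and its formal inverse, in either order. -/
def CellExt.Opposite {m : ℕ} {C : StrictNCat.{u} m} (Γ : CellExt C)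
    (γ δ : Γ.signed.Gen) : Prop :=
  γ.1 = δ.1 ∧ γ.2 ≠ δ.2

/-- Disjoint union of cellular extensions. -/
def CellExt.sum {m : ℕ} {C : StrictNCat.{u} m} (Γ Δ : CellExt C) : CellExt C where
  Gen := Γ.Gen ⊕ Δ.Gen
  s := Sum.elim Γ.s Δ.s
  t := Sum.elim Γ.t Δ.t
  src_eq := by
    rintro (γ | γ) i hi
    · exact Γ.src_eq γ i hi
    · exact Δ.src_eq γ i hi
  tgt_eq := by
    rintro (γ | γ) i hi
    · exact Γ.tgt_eq γ i hi
    · exact Δ.tgt_eq γ i hi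

/-- The `(m+1)`-cells of the free `(m+1)`-category `C[Γ]`. -/
abbrev CellExt.FreeCells {m : ℕ} {C : StrictNCat.{u} m} (Γ : CellExt C) : Type u :=
  FreeExt.Cells C Γ (fun _ _ => False)

/-- The `(m+1)`-cells of the free `(m+1,m)`-category `C(Γ)`, in which the `(m+1)`-cells are
invertible. -/
abbrev CellExt.InvCells {m : ℕ} {C : StrictNCat.{u} m} (Γ : CellExt C) : Type u :=
  FreeExt.Cells C Γ.signed Γ.Opposite

/-- A generator of `E` and its formal inverse, in either order, among the generators of `R` and
the signed generators of `E`. -/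
def CellExt.MixedOpposite {m : ℕ} {C : StrictNCat.{u} m} (R E : CellExt C)
    (γ δ : (R.sum E.signed).Gen) : Prop :=
  ∃ γ' δ' : E.signed.Gen, γ = Sum.inr γ' ∧ δ = Sum.inr δ' ∧ E.Opposite γ' δ'

/-- The `(m+1)`-cells of `C[R, E ⊔ E⁻] / Inv(E)`: the free `(m+1)`-category over `C` on `R` and
`E`, with the cells of `E` made invertible. -/
abbrev CellExt.MixedCells {m : ℕ} {C : StrictNCat.{u} m} (R E : CellExt C) : Type u :=
  FreeExt.Cells C (R.sum E.signed) (R.MixedOpposite E)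

/-! ### Whiskers and rewriting steps -/

/-- The data of a whisker
`left (m-1) ⋆₍ₘ₋₁₎ (⋯ (left 0 ⋆₀ - ⋆₀ right 0) ⋯) ⋆₍ₘ₋₁₎ right (m-1)` of an `m`-category, where
`left k` and `right k` are `(k+1)`-cells. Entries at an index `k ≥ m` are not used. -/
structure Whisker {m : ℕ} (C : StrictNCat.{u} m) where
  left : ℕ → C.Cell
  right : ℕ → C.Cell
  left_cell : ∀ k, k + 1 < m → C.src (k + 1) (left k) = left k
  right_cell : ∀ k, k + 1 < m → C.src (k + 1) (right k) = right k

namespace Whisker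

variable {m : ℕ} {C : StrictNCat.{u} m} {Γ : CellExt C} {I : Γ.Gen → Γ.Gen → Prop}

/-- The first `k` layers of the whisker around an `m`-cell. -/
def base (W : Whisker C) (u : C.Cell) : ℕ → C.Cell
  | 0 => u
  | k + 1 => C.comp k (C.comp k (W.left k) (base W u k)) (W.right k)

/-- The whisker is composable with the `m`-cell `u`. -/
def Fits (W : Whisker C) (u : C.Cell) : Prop :=
  ∀ k < m, C.tgt k (W.left k) = C.src k (W.base u k) ∧
    C.tgt k (W.base u k) = C.src k (W.right k)

/-- The first `k` layers of the whisker around an `(m+1)`-cell. -/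
noncomputable def layers (W : Whisker C) (x : FreeExt.Cells C Γ I) : ℕ → FreeExt.Cells C Γ I
  | 0 => x
  | k + 1 => FreeExt.comp k (FreeExt.comp k (FreeExt.unit I (W.left k)) (layers W x k))
      (FreeExt.unit I (W.right k))

/-- The `(m+1)`-cell `W[x]`, meaningful when the whisker fits the source of `x`. -/
noncomputable def act (W : Whisker C) (x : FreeExt.Cells C Γ I) : FreeExt.Cells C Γ I :=
  W.layers x m

/-- The whisker around `u` all of whose components are identities. -/
def trivial (u : C.Cell) : Whisker C where
  left k := C.src k u
  right k := C.tgt k u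
  left_cell k hk := C.src_src_le (Nat.le_succ k) hk u
  right_cell k hk := C.src_tgt_le (Nat.le_succ k) hk u

theorem trivial_base (u : C.Cell) : ∀ k ≤ m, (trivial u).base u k = u
  | 0, _ => rfl
  | k + 1, hk => by
    have ih := trivial_base u k (Nat.le_of_succ_le hk)
    change C.comp k (C.comp k (C.src k u) ((trivial u).base u k)) (C.tgt k u) = u
    rw [ih, C.src_unit hk, C.tgt_unit hk]

theorem trivial_fits (u : C.Cell) : (trivial u).Fits u := by
  intro k hk
  rw [trivial_base u k hk.le]
  exact ⟨C.tgt_src_le le_rfl hk u, (C.src_tgt_le le_rfl hk u).symm⟩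

theorem trivial_layers (x : FreeExt.Cells C Γ I) :
    ∀ k ≤ m, (trivial (FreeExt.dom x)).layers x k = x
  | 0, _ => rfl
  | k + 1, hk => by
    have ih := trivial_layers x k (Nat.le_of_succ_le hk)
    have h₁ := (FreeExt.cat C Γ I).src_unit (Nat.lt_succ_of_lt hk) x
    have h₂ := (FreeExt.cat C Γ I).tgt_unit (Nat.lt_succ_of_lt hk) x
    change FreeExt.comp k (FreeExt.src k x) x = x at h₁
    change FreeExt.comp k x (FreeExt.tgt k x) = x at h₂
    rw [FreeExt.src_lt hk] at h₁
    rw [FreeExt.tgt_lt hk, FreeExt.tgt_dom_cod hk] at h₂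
    change FreeExt.comp k (FreeExt.comp k (FreeExt.unit I (C.src k (FreeExt.dom x)))
      ((trivial (FreeExt.dom x)).layers x k)) (FreeExt.unit I (C.tgt k (FreeExt.dom x))) = x
    rw [ih, h₁, h₂]

end Whisker

namespace FreeExt

variable {m : ℕ} {C : StrictNCat.{u} m} {Γ : CellExt C} {I : Γ.Gen → Γ.Gen → Prop}

/-- The cell has the form `W[γ]` with `W` a whisker and `γ` a generating cell in `X`. -/
def IsStepOf (X : Set Γ.Gen) (x : Cells C Γ I) : Prop :=
  ∃ γ ∈ X, ∃ W : Whisker C, W.Fits (Γ.s γ) ∧ x = W.act (gen I γ)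

/-- The cells of size one. In the free `(m+1,m)`-category these are the whiskered generating
cells and their inverses. -/
def IsStep (x : Cells C Γ I) : Prop := IsStepOf Set.univ x

/-- The identity cells. -/
def IsIdentity (x : Cells C Γ I) : Prop := x = unit I (dom x)

theorem isStep_gen (γ : Γ.Gen) : IsStep (gen I γ) :=
  ⟨γ, Set.mem_univ γ, Whisker.trivial (Γ.s γ), Whisker.trivial_fits _,
    (Whisker.trivial_layers (gen I γ) m le_rfl).symm⟩

/-- Two cells that are mutually inverse for `⋆ₘ`. -/
def IsInverse (x y : Cells C Γ I) : Prop :=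
  cod x = dom y ∧ cod y = dom x ∧ comp m x y = unit I (dom x) ∧ comp m y x = unit I (dom y)

end FreeExt

/-- The `m`-cell `u` reduces into `v`: there is a non-identity `(m+1)`-cell from `u` to `v` in the
free `(m+1)`-category. -/
def CellExt.Reduces {m : ℕ} {C : StrictNCat.{u} m} (Γ : CellExt C) (u v : C.Cell) : Prop :=
  ∃ x : Γ.FreeCells, ¬ FreeExt.IsIdentity x ∧ FreeExt.dom x = u ∧ FreeExt.cod x = v

/-- There is no infinite reduction sequence. -/
def CellExt.Terminating {m : ℕ} {C : StrictNCat.{u} m} (Γ : CellExt C) : Prop :=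
  ¬ ∃ u : ℕ → C.Cell, ∀ k, Γ.Reduces (u k) (u (k + 1))

/-! ### Polygraphs modulo -/

/-- The elements of `E⊤ × R*⁽¹⁾ × E⊤` (fibre products over the `m`-cells). -/
structure EREGen {m : ℕ} {C : StrictNCat.{u} m} (R E : CellExt C) where
  pre : E.InvCells
  rule : R.FreeCells
  post : E.InvCells
  isStep : FreeExt.IsStep rule
  pre_rule : FreeExt.cod pre = FreeExt.dom rule
  rule_post : FreeExt.cod rule = FreeExt.dom post

/-- The cellular extension `ᴇRᴇ`. -/
def CellExt.ere {m : ℕ} {C : StrictNCat.{u} m} (R E : CellExt C) : CellExt C where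
  Gen := EREGen R E
  s γ := FreeExt.dom γ.pre
  t γ := FreeExt.cod γ.post
  src_eq γ i hi := by
    rw [← FreeExt.src_dom_cod hi γ.pre, γ.pre_rule, ← FreeExt.src_dom_cod hi γ.rule, γ.rule_post,
      FreeExt.src_dom_cod hi γ.post]
  tgt_eq γ i hi := by
    rw [← FreeExt.tgt_dom_cod hi γ.pre, γ.pre_rule, ← FreeExt.tgt_dom_cod hi γ.rule, γ.rule_post,
      FreeExt.tgt_dom_cod hi γ.post]

/-- A primary rule `ρ` as the element `(1, ρ, 1)` of `ᴇRᴇ`. -/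
def EREGen.ofRule {m : ℕ} {C : StrictNCat.{u} m} {R : CellExt C} (E : CellExt C) (ρ : R.Gen) :
    EREGen R E where
  pre := FreeExt.unit _ (R.s ρ)
  rule := FreeExt.gen _ ρ
  post := FreeExt.unit _ (R.t ρ)
  isStep := FreeExt.isStep_gen ρ
  pre_rule := rfl
  rule_post := rfl

/-- An `(m+1)`-polygraph modulo `(R, E, S)`: `base` is the underlying `m`-polygraph of `R`, the
generating `(m+1)`-cells of `R` and of `E` are cellular extensions of the free `m`-category on
`base`, and `R ⊆ S ⊆ ᴇRᴇ`. (If `E` is first given over the free `m`-category on a smaller set of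
generating `m`-cells, it is regarded as a cellular extension of the larger free `m`-category, as
the `m`-cells of `E⊤` and `S*` have to agree.) -/
structure PolygraphModulo (m : ℕ) where
  base : Polygraph.{u} m
  R : CellExt base.free
  E : CellExt base.free
  rules : Set (EREGen R E)
  rule_mem : ∀ ρ : R.Gen, EREGen.ofRule E ρ ∈ rules

namespace PolygraphModulo

variable {m : ℕ} (P : PolygraphModulo.{u} m)

/-- The cellular extension `S`. -/
noncomputable def S : CellExt P.base.free where
  Gen := P.rules
  s γ := (P.R.ere P.E).s γ.1
  t γ := (P.R.ere P.E).t γ.1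
  src_eq γ := (P.R.ere P.E).src_eq γ.1
  tgt_eq γ := (P.R.ere P.E).tgt_eq γ.1

/-- The horizontal cells: `(m+1)`-cells of `S*`. -/
abbrev HCell : Type u := P.S.FreeCells

/-- The vertical cells: `(m+1)`-cells of `E⊤`. -/
abbrev VCell : Type u := P.E.InvCells

/-- The identity horizontal cell of an `m`-cell. -/
noncomputable abbrev hid (u : P.base.free.Cell) : P.HCell := FreeExt.unit _ u

/-- The identity vertical cell of an `m`-cell. -/
noncomputable abbrev vid (u : P.base.free.Cell) : P.VCell := FreeExt.unit _ u

/-- The generators of `S` that are primary rules. -/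
def primary : Set P.S.Gen := {γ | ∃ ρ : P.R.Gen, γ.1 = EREGen.ofRule P.E ρ}

/-- The functor `E⊤ → R*(E)`. -/
noncomputable def realizeE : P.VCell → P.R.MixedCells P.E :=
  FreeExt.lift (fun γ => FreeExt.gen _ (Sum.inr γ)) (fun _ => ⟨rfl, rfl⟩)
    (fun γ δ hI h h' => (FreeExt.comp_mk_top _ _ h).trans (FreeExt.mk_eq
      (CellRel.inverse (Γ := P.R.sum P.E.signed) (Sum.inr γ) (Sum.inr δ) h h'
        ⟨γ, δ, rfl, rfl, hI⟩)))

/-- The functor `R* → R*(E)`. -/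
noncomputable def realizeR : P.R.FreeCells → P.R.MixedCells P.E :=
  FreeExt.lift (fun γ => FreeExt.gen _ (Sum.inl γ)) (fun _ => ⟨rfl, rfl⟩)
    (fun _ _ hI => hI.elim)

theorem realizeE_ends (e : P.VCell) : FreeExt.dom (P.realizeE e) = FreeExt.dom e ∧
    FreeExt.cod (P.realizeE e) = FreeExt.cod e := FreeExt.lift_ends _ _ _ e

theorem realizeR_ends (f : P.R.FreeCells) : FreeExt.dom (P.realizeR f) = FreeExt.dom f ∧
    FreeExt.cod (P.realizeR f) = FreeExt.cod f := FreeExt.lift_ends _ _ _ f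

/-- The functor `S* → R*(E)` that sends a generator `(e, f, e')` to `e ⋆ₘ f ⋆ₘ e'`. -/
noncomputable def realizeS : P.HCell → P.R.MixedCells P.E :=
  FreeExt.lift
    (fun γ => FreeExt.comp m (FreeExt.comp m (P.realizeE γ.1.pre) (P.realizeR γ.1.rule))
      (P.realizeE γ.1.post))
    (fun γ => by
      have h₁ := FreeExt.dom_comp_top (x := P.realizeE γ.1.pre) (y := P.realizeR γ.1.rule)
        (by rw [(P.realizeE_ends _).2, (P.realizeR_ends _).1, γ.1.pre_rule])
      have h₂ := FreeExt.dom_comp_top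
        (x := FreeExt.comp m (P.realizeE γ.1.pre) (P.realizeR γ.1.rule))
        (y := P.realizeE γ.1.post)
        (by rw [h₁.2, (P.realizeR_ends _).2, (P.realizeE_ends _).1, γ.1.rule_post])
      exact ⟨h₂.1.trans (h₁.1.trans (P.realizeE_ends _).1), h₂.2.trans (P.realizeE_ends _).2⟩)
    (fun _ _ hI => hI.elim)

end PolygraphModulo

/-! ### Square cells -/

/-- A square extension of the pair `(E⊤, S*)`. -/
structure SquareExt {m : ℕ} (P : PolygraphModulo.{u} m) where
  Sq : Type u
  top : Sq → P.HCell
  bot : Sq → P.HCell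
  left : Sq → P.VCell
  right : Sq → P.VCell
  top_left : ∀ A, FreeExt.dom (left A) = FreeExt.dom (top A)
  bot_left : ∀ A, FreeExt.cod (left A) = FreeExt.dom (bot A)
  top_right : ∀ A, FreeExt.dom (right A) = FreeExt.cod (top A)
  bot_right : ∀ A, FreeExt.cod (right A) = FreeExt.cod (bot A)

open FreeExt in
/-- The pastings that represent the square cells of the free `m`-category enriched in double
categories with invertible vertical cells, generated by `E`, `S` and the squares of
`E ⋊ Γ ∪ Peiff(E⊤, S*)`. The indices are the boundary: top and bottom horizontal cells, left and
right vertical cells. (The axioms of double categories identify some pastings with the same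
boundary; which boundaries bound a square cell does not depend on this.) -/
inductive SquareCell {m : ℕ} {P : PolygraphModulo.{u} m} (Γ : SquareExt P) :
    P.HCell → P.HCell → P.VCell → P.VCell → Type u
  /-- The square of `E ⋊ Γ` obtained from `A` by the action of `e₁` and `e₂`: its top is the cell
  `e₁ ⋆ top A` and its bottom is the cell `e₂⁻ ⋆ bot A`, whenever these composites in `R*(E)`
  are cells of `S*`. -/
  | act (A : Γ.Sq) (e₁ e₂ e₂' : P.VCell) (f g : P.HCell)
      (h₁ : cod e₁ = dom (Γ.left A)) (h₂ : cod (Γ.left A) = dom e₂) (hinv : IsInverse e₂ e₂')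
      (hf : P.realizeS f = comp m (P.realizeE e₁) (P.realizeS (Γ.top A)))
      (hg : P.realizeS g = comp m (P.realizeE e₂') (P.realizeS (Γ.bot A))) :
      SquareCell Γ f g (comp m (comp m e₁ (Γ.left A)) e₂) (Γ.right A)
  /-- Peiffer squares, of the first form. -/
  | peifferHV (i : ℕ) (hi : i < m) (f : P.HCell) (e : P.VCell)
      (h : P.base.free.tgt i (dom f) = P.base.free.src i (dom e)) :
      SquareCell Γ (comp i f (P.hid (dom e))) (comp i f (P.hid (cod e)))
        (comp i (P.vid (dom f)) e) (comp i (P.vid (cod f)) e)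
  /-- Peiffer squares, of the second form. -/
  | peifferVH (i : ℕ) (hi : i < m) (f : P.HCell) (e : P.VCell)
      (h : P.base.free.tgt i (dom e) = P.base.free.src i (dom f)) :
      SquareCell Γ (comp i (P.hid (dom e)) f) (comp i (P.hid (cod e)) f)
        (comp i e (P.vid (dom f))) (comp i e (P.vid (cod f)))
  /-- The identity square on a horizontal cell. -/
  | idH (f : P.HCell) : SquareCell Γ f f (P.vid (dom f)) (P.vid (cod f))
  /-- The identity square on a vertical cell. -/
  | idV (e : P.VCell) : SquareCell Γ (P.hid (dom e)) (P.hid (cod e)) e e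
  /-- Pasting along a vertical cell. -/
  | compV {f g f' g' : P.HCell} {e d c : P.VCell} (A : SquareCell Γ f g e d)
      (B : SquareCell Γ f' g' d c) : SquareCell Γ (comp m f f') (comp m g g') e c
  /-- Pasting along a horizontal cell. -/
  | compH {f g h : P.HCell} {e e' d d' : P.VCell} (A : SquareCell Γ f g e e')
      (B : SquareCell Γ g h d d') : SquareCell Γ f h (comp m e d) (comp m e' d')
  /-- The inverse of a square for the pasting along horizontal cells. -/
  | invH {f g : P.HCell} {e e' d d' : P.VCell} (A : SquareCell Γ f g e e')
      (h : IsInverse e d) (h' : IsInverse e' d') : SquareCell Γ g f d d'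
  /-- The composite `A ⋆ᵢ B` given by the enrichment; whiskering a square by `m`-cells is the case
  where one of the squares is an identity. -/
  | star (i : ℕ) (hi : i < m) {f g f' g' : P.HCell} {e d e' d' : P.VCell}
      (A : SquareCell Γ f g e d) (B : SquareCell Γ f' g' e' d')
      (h : P.base.free.tgt i (dom f) = P.base.free.src i (dom f')) :
      SquareCell Γ (comp i f f') (comp i g g') (comp i e e') (comp i d d')

/-! ### Branchings -/

open FreeExt in
/-- A branching `(f, e, g)` of `S` modulo `E`. The branchings `(f, g)` are those where `e` is an
identity, and the branchings `(f, e)` are those where `g` is an identity. -/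
structure Branching {m : ℕ} (P : PolygraphModulo.{u} m) where
  f : P.HCell
  e : P.VCell
  g : P.HCell
  dom_f : dom f = dom e
  dom_g : dom g = cod e
  nontrivial : ¬ IsIdentity f

namespace Branching

open FreeExt

variable {m : ℕ} {P : PolygraphModulo.{u} m}

/-- There are `f'`, `g'` in `S*`, `e'` in `E⊤` and a square cell with boundary
`(f ⋆ₘ f', g ⋆ₘ g', e, e')`. -/
def GammaConfluent (Γ : SquareExt P) (b : Branching P) : Prop :=
  ∃ (f' g' : P.HCell) (e' : P.VCell), cod b.f = dom f' ∧ cod b.g = dom g' ∧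
    cod f' = dom e' ∧ cod g' = cod e' ∧
    Nonempty (SquareCell Γ (comp m b.f f') (comp m b.g g') b.e e')

/-- `f` is of size one, and the sizes of `g` and `e` add up to one. -/
def IsLocal (b : Branching P) : Prop :=
  IsStep b.f ∧ ((IsStep b.g ∧ IsIdentity b.e) ∨ (IsIdentity b.g ∧ IsStep b.e))

/-- Local aspherical branchings `(f, f)`. -/
def IsAspherical (b : Branching P) : Prop := IsIdentity b.e ∧ b.f = b.g

/-- Local Peiffer branchings `(f ⋆ᵢ v, u ⋆ᵢ g)`, where `(f, g)` and `(g, f)` are not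
distinguished. -/
def IsPeiffer (b : Branching P) : Prop :=
  IsIdentity b.e ∧ ∃ i < m, ∃ f g : P.HCell, IsStep f ∧ IsStep g ∧
    P.base.free.tgt i (dom f) = P.base.free.src i (dom g) ∧
    ((b.f = comp i f (P.hid (dom g)) ∧ b.g = comp i (P.hid (dom f)) g) ∨
      (b.g = comp i f (P.hid (dom g)) ∧ b.f = comp i (P.hid (dom f)) g))

/-- Local Peiffer branchings modulo `(f ⋆ᵢ v, u ⋆ᵢ e)` and `(w ⋆ᵢ f, e ⋆ᵢ u)`. -/
def IsPeifferModulo (b : Branching P) : Prop :=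
  IsIdentity b.g ∧ ∃ i < m, ∃ (f : P.HCell) (e : P.VCell), IsStep f ∧ IsStep e ∧
    ((P.base.free.tgt i (dom f) = P.base.free.src i (dom e) ∧
        b.f = comp i f (P.hid (dom e)) ∧ b.e = comp i (P.vid (dom f)) e) ∨
      (P.base.free.tgt i (dom e) = P.base.free.src i (dom f) ∧
        b.f = comp i (P.hid (dom e)) f ∧ b.e = comp i e (P.vid (dom f))))

/-- Overlapping branchings, and overlapping branchings modulo: the remaining local ones. -/
def IsOverlapping (b : Branching P) : Prop :=
  b.IsLocal ∧ ¬ b.IsAspherical ∧ ¬ b.IsPeiffer ∧ ¬ b.IsPeifferModulo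

/-- The order `⊑` on branchings: the second one is obtained from the first one by a whisker. -/
def Sub (b b' : Branching P) : Prop :=
  ∃ W : Whisker P.base.free, W.Fits (dom b.f) ∧
    W.act b.f = b'.f ∧ W.act b.e = b'.e ∧ W.act b.g = b'.g

/-- Critical branchings, and critical branchings modulo: the overlapping ones that are minimal
for `⊑` among local branchings. -/
def IsCritical (b : Branching P) : Prop :=
  b.IsOverlapping ∧ ∀ b' : Branching P, b'.IsLocal → b'.Sub b → b' = b

end Branching

/-- Every local branching of `S` modulo `E` is `Γ`-confluent modulo `E`. -/
def PolygraphModulo.LocallyGammaConfluent {m : ℕ} (P : PolygraphModulo.{u} m)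
    (Γ : SquareExt P) : Prop :=
  ∀ b : Branching P, b.IsLocal → b.GammaConfluent Γ

/-! Only the passage from critical to local branchings needs an argument. The difficulty is that
condition a₀ compares a step of `S` with a step of `R` only, while a local branching may consist of
two arbitrary steps of `S`. The way around is to prove confluence of all branchings modulo, by a
Newman argument in which arbitrary steps are compared through primary ones.

The test branchings (`IsTest`) are those of the shape occurring in a₀ and b₀, critical or not. They
are all confluent, by induction on their source. Aspherical ones are closed by an identity square,
Peiffer ones by the interchange law, Peiffer ones modulo by a Peiffer square. An overlapping one
that is not critical is a nontrivial whisker around a smaller local branching, which is again a test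
(`IsTest.of_sub`), and whiskering its confluence square closes the large one
(`GammaConfluent.of_sub`). The induction is well founded because a nontrivial whisker adds
generators, counted dimension by dimension in the free category (`Grading`, `Sub.measure_lt_or_eq`).

The Newman induction runs along `Below`: steps of `S` interleaved with cells of `E⊤`. Termination of
`ᴇRᴇ` makes it well founded, since a step of `S` between two cells of `E⊤` comes from a single
generator of `ᴇRᴇ` (`ModStep.reduces`). The induction statement `CoherentAt` speaks of all pairs of
reductions to normal forms, so that squares with a common intermediate reduction can always be found
and pasted (`Coherent.trans`, `Joins.coherent`).

For steps `f` and `g` whose sources are linked by `e`, the step `g` opens with a cell `c` of `E⊤`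
into the source of a primary step `p` (`exists_primary`). Any step of `S` can be carried along a
cell of `E⊤`, one step of `E⊤` at a time (`TestJoins.transport`): b₀ closes each local piece, and
termination forces the opposite side of the square to contain a step, since otherwise the square
would exhibit a cycle. Carried to the source of `p`, both `f` and `g` meet `p` by a₀, hence cohere
with each other (`TestJoins.coherent_step`). Transport also shows that a cell equivalent modulo `E`
to a normal form is normal, which settles reductions that are identities. -/

namespace FreeExt

/-! ### Composition laws in free extensions -/

variable {m : ℕ} {C : StrictNCat.{u} m} {Γ : CellExt C} {I : Γ.Gen → Γ.Gen → Prop}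

theorem unit_comp_top {c : C.Cell} {x : Cells C Γ I} (h : c = dom x) :
    comp m (unit I c) x = x := by
  subst h
  have := (cat C Γ I).src_unit (Nat.lt_succ_self m) x
  change comp m (src m x) x = x at this
  rwa [src_top] at this

theorem comp_top_unit {c : C.Cell} {x : Cells C Γ I} (h : cod x = c) :
    comp m x (unit I c) = x := by
  subst h
  have := (cat C Γ I).tgt_unit (Nat.lt_succ_self m) x
  change comp m x (tgt m x) = x at this
  rwa [tgt_top] at this

theorem comp_top_assoc {x y z : Cells C Γ I} (h : cod x = dom y) (h' : cod y = dom z) :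
    comp m (comp m x y) z = comp m x (comp m y z) :=
  (cat C Γ I).assoc (Nat.lt_succ_self m) x y z (composable_of_top h) (composable_of_top h')

theorem dom_comp {x y : Cells C Γ I} (h : cod x = dom y) : dom (comp m x y) = dom x :=
  (dom_comp_top h).1

theorem cod_comp {x y : Cells C Γ I} (h : cod x = dom y) : cod (comp m x y) = cod y :=
  (dom_comp_top h).2

theorem comp_lt_assoc {i : ℕ} (hi : i < m) {x y z : Cells C Γ I}
    (h : C.tgt i (dom x) = C.src i (dom y)) (h' : C.tgt i (dom y) = C.src i (dom z)) :
    comp i (comp i x y) z = comp i x (comp i y z) :=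
  (cat C Γ I).assoc (Nat.lt_succ_of_lt hi) x y z (composable_of_lt hi h) (composable_of_lt hi h')

theorem interchange_top {i : ℕ} (hi : i < m) {x x' y y' : Cells C Γ I} (hx : cod x = dom x')
    (hy : cod y = dom y') (h : C.tgt i (dom x) = C.src i (dom y)) :
    comp i (comp m x x') (comp m y y') = comp m (comp i x y) (comp i x' y') :=
  (cat C Γ I).interchange hi (Nat.lt_succ_self m) x x' y y' (composable_of_top hx)
    (composable_of_top hy) (composable_of_lt hi h)
    (composable_of_lt hi (by rw [← hx, ← hy, tgt_dom_cod hi, src_dom_cod hi, h]))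

theorem interchange_lt {i j : ℕ} (hij : i < j) (hj : j < m) {x x' y y' : Cells C Γ I}
    (hx : C.tgt j (dom x) = C.src j (dom x')) (hy : C.tgt j (dom y) = C.src j (dom y'))
    (h : C.tgt i (dom x) = C.src i (dom y)) (h' : C.tgt i (dom x') = C.src i (dom y')) :
    comp i (comp j x x') (comp j y y') = comp j (comp i x y) (comp i x' y') :=
  (cat C Γ I).interchange hij (Nat.lt_succ_of_lt hj) x x' y y' (composable_of_lt hj hx)
    (composable_of_lt hj hy) (composable_of_lt (hij.trans hj) h)
    (composable_of_lt (hij.trans hj) h')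

theorem comp_left_unit_comp {i : ℕ} (hi : i < m) {c : C.Cell} {x y : Cells C Γ I}
    (hc : C.tgt i c = C.src i (dom x)) (h : cod x = dom y) :
    comp i (unit I c) (comp m x y) = comp m (comp i (unit I c) x) (comp i (unit I c) y) := by
  have := interchange_top (x := unit I c) (x' := unit I c) hi rfl h hc
  rwa [unit_comp_top (c := c) (x := unit I c) rfl] at this

theorem comp_comp_right_unit {i : ℕ} (hi : i < m) {c : C.Cell} {x y : Cells C Γ I}
    (hc : C.tgt i (dom x) = C.src i c) (h : cod x = dom y) :
    comp i (comp m x y) (unit I c) = comp m (comp i x (unit I c)) (comp i y (unit I c)) := by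
  have := interchange_top (y := unit I c) (y' := unit I c) hi h rfl hc
  rwa [unit_comp_top (c := c) (x := unit I c) rfl] at this

/-- `x ⋆ᵢ y` as its left factor followed by its right factor. -/
theorem comp_lt_eq_left_right {i : ℕ} (hi : i < m) {x y : Cells C Γ I}
    (h : C.tgt i (dom x) = C.src i (dom y)) :
    comp i x y = comp m (comp i x (unit I (dom y))) (comp i (unit I (cod x)) y) := by
  have := interchange_top (x := x) (x' := unit I (cod x)) (y := unit I (dom y)) (y' := y) hi rfl
    rfl h
  rwa [comp_top_unit rfl, unit_comp_top rfl] at this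

/-- `x ⋆ᵢ y` as its right factor followed by its left factor. -/
theorem comp_lt_eq_right_left {i : ℕ} (hi : i < m) {x y : Cells C Γ I}
    (h : C.tgt i (dom x) = C.src i (dom y)) :
    comp i x y = comp m (comp i (unit I (dom x)) y) (comp i x (unit I (cod y))) := by
  have := interchange_top (x := unit I (dom x)) (x' := x) (y := y) (y' := unit I (cod y)) hi rfl
    rfl h
  rwa [comp_top_unit rfl, unit_comp_top rfl] at this

theorem isIdentity_unit (c : C.Cell) : IsIdentity (unit (Γ := Γ) I c) := rfl

theorem IsIdentity.dom_eq_cod {x : Cells C Γ I} (h : IsIdentity x) : dom x = cod x :=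
  (congrArg cod h).symm

/-! ### Whiskered cells, layer by layer -/

/-- `IsLayered x k y` holds if `y` is `x` with `k` layers of a whisker around it. -/
inductive IsLayered (x : Cells C Γ I) : ℕ → Cells C Γ I → Prop
  | zero : IsLayered x 0 x
  | succ {k : ℕ} {y : Cells C Γ I} (l r : C.Cell) (hk : k < m)
      (hl : k + 1 < m → C.src (k + 1) l = l) (hr : k + 1 < m → C.src (k + 1) r = r)
      (hly : C.tgt k l = C.src k (dom y)) (hyr : C.tgt k (dom y) = C.src k r)
      (hy : IsLayered x k y) :
      IsLayered x (k + 1) (comp k (comp k (unit I l) y) (unit I r))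

theorem dom_layer {k : ℕ} (hk : k < m) {l r : C.Cell} {y : Cells C Γ I}
    (hly : C.tgt k l = C.src k (dom y)) (hyr : C.tgt k (dom y) = C.src k r) :
    dom (comp k (comp k (unit I l) y) (unit I r)) = C.comp k (C.comp k l (dom y)) r ∧
    cod (comp k (comp k (unit I l) y) (unit I r)) = C.comp k (C.comp k l (cod y)) r := by
  have h₁ := dom_comp_lt (x := unit I l) (y := y) hk hly
  have h₂ := dom_comp_lt (x := comp k (unit I l) y) (y := unit I r) hk
    (by rw [h₁.1, dom_unit, C.tgt_comp hk _ _ hly, hyr]; rfl)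
  rw [h₁.1, h₁.2] at h₂
  exact h₂

/-- Cells that are composable along dimension `k` are parallel in all dimensions below `k`. -/
theorem src_lt_layer {i k : ℕ} (hik : i < k) (hk : k < m) {l r y : C.Cell}
    (hly : C.tgt k l = C.src k y) (hyr : C.tgt k y = C.src k r) :
    C.src i (C.comp k (C.comp k l y) r) = C.src i y ∧
    C.tgt i (C.comp k (C.comp k l y) r) = C.tgt i y ∧
    C.src i l = C.src i y ∧ C.tgt i l = C.tgt i y ∧ C.src i r = C.src i y ∧
    C.tgt i r = C.tgt i y := by
  have a₁ : C.src i l = C.src i y := by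
    rw [← C.src_tgt_lt hik hk, hly, C.src_src_lt hik hk]
  have a₂ : C.tgt i l = C.tgt i y := by
    rw [← C.tgt_tgt_lt hik hk, hly, C.tgt_src_lt hik hk]
  have a₃ : C.src i r = C.src i y := by
    rw [← C.src_src_lt hik hk, ← hyr, C.src_tgt_lt hik hk]
  have a₄ : C.tgt i r = C.tgt i y := by
    rw [← C.tgt_src_lt hik hk, ← hyr, C.tgt_tgt_lt hik hk]
  have hc : C.tgt k (C.comp k l y) = C.src k r := by rw [C.tgt_comp hk _ _ hly, hyr]
  have a₅ : C.src k (C.comp k (C.comp k l y) r) = C.src k l := by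
    rw [C.src_comp hk _ _ hc, C.src_comp hk _ _ hly]
  refine ⟨?_, ?_, a₁, a₂, a₃, a₄⟩
  · rw [← C.src_src_lt hik hk, a₅, C.src_src_lt hik hk, a₁]
  · rw [← C.tgt_src_lt hik hk, a₅, C.tgt_src_lt hik hk, a₂]

/-- A whisker composes its layers in increasing dimension, so a further composite along a low
dimension has to be pushed inwards. In the dimension of the outermost layer, associativity absorbs
it into `l`. Below that dimension, `c` is split as `c ⋆ₖ t ⋆ₖ t` with `t` its `k`-target, and
interchange distributes the three factors over `l`, `y` and `r`; the induction hypothesis then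
absorbs `t` into `y`. -/
theorem IsLayered.comp_left {x : Cells C Γ I} {k : ℕ} {y : Cells C Γ I} (hy : IsLayered x k y) :
    ∀ (i : ℕ) (c : C.Cell), i < k → (k < m → C.src k c = c) → C.tgt i c = C.src i (dom y) →
      IsLayered x k (comp i (unit I c) y) := by
  induction hy with
  | zero => exact fun i c hi => absurd hi (Nat.not_lt_zero i)
  | @succ k y l r hk hl hr hly hyr hy ih =>
    intro i c hi hc h
    rw [(dom_layer hk hly hyr).1] at h
    have hd := (dom_comp_lt (x := unit I l) (y := y) hk hly).1
    rw [dom_unit] at hd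
    have hlyr : C.tgt k (dom (comp k (unit I l) y)) = C.src k (dom (unit (Γ := Γ) I r)) := by
      rw [hd, C.tgt_comp hk _ _ hly, hyr]; rfl
    rcases Nat.lt_succ_iff_lt_or_eq.1 hi with hik | rfl
    · obtain ⟨a₀, -, a₁, a₂, a₃, a₄⟩ := src_lt_layer hik hk hly hyr
      have him := hik.trans hk
      rw [a₀] at h
      have ht : C.tgt i (C.tgt k c) = C.src i (dom y) := by rw [C.tgt_tgt_lt hik hk, h]
      have hcl : C.tgt i c = C.src i l := by rw [h, a₁]
      have hcr : C.tgt i (C.tgt k c) = C.src i r := by rw [ht, a₃]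
      have hcc : C.tgt k c = C.src k (C.tgt k c) := (C.src_tgt_le le_rfl hk c).symm
      have hdl : dom (comp i (unit I (C.tgt k c)) y) = C.comp i (C.tgt k c) (dom y) :=
        (dom_comp_lt (x := unit I (C.tgt k c)) him ht).1
      -- Both interchanges are read backwards, the copies of the `k`-target of `c` being merged into
      -- `c` by the unit law.
      have key : comp i (unit I c) (comp k (comp k (unit I l) y) (unit I r)) =
          comp k (comp k (unit I (C.comp i c l)) (comp i (unit I (C.tgt k c)) y))
            (unit I (C.comp i (C.tgt k c) r)) := by
        rw [← unit_comp him hcl, ← unit_comp him hcr]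
        rw [← interchange_lt hik hk (x := unit I c) (x' := unit I (C.tgt k c)) (y := unit I l)
          (y' := y) hcc hly hcl ht]
        rw [unit_comp hk hcc, C.tgt_unit hk]
        rw [← interchange_lt hik hk (x := unit I c) (x' := unit I (C.tgt k c)) (y' := unit I r)
          hcc hlyr
          (by rw [hd, ← C.src_src_lt hik hk, C.src_comp hk _ _ hly, C.src_src_lt hik hk]
              exact hcl) hcr]
        rw [unit_comp hk hcc, C.tgt_unit hk]
      rw [key]
      refine IsLayered.succ _ _ hk (fun hk' => ?_) (fun hk' => ?_) ?_ ?_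
        (ih i (C.tgt k c) hik (fun _ => C.src_tgt_le le_rfl hk c) ht)
      · rw [C.src_comp_lt (hik.trans k.lt_succ_self) hk' _ _ hcl, hc hk', hl hk']
      · rw [C.src_comp_lt (hik.trans k.lt_succ_self) hk' _ _ hcr,
          C.src_tgt_le k.le_succ hk', hr hk']
      · rw [hdl, C.tgt_comp_lt hik hk _ _ hcl, C.src_comp_lt hik hk _ _ ht, hly,
          C.src_tgt_le le_rfl hk]
      · rw [hdl, C.tgt_comp_lt hik hk _ _ ht, C.src_comp_lt hik hk _ _ hcr, hyr,
          C.src_tgt_le le_rfl hk, C.tgt_tgt_le le_rfl hk]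
    · have hcl : C.tgt i c = C.src i l := by
        rw [h, C.src_comp hk _ _ (by rw [C.tgt_comp hk _ _ hly, hyr]), C.src_comp hk _ _ hly]
      have key : comp i (unit I c) (comp i (comp i (unit I l) y) (unit I r)) =
          comp i (comp i (unit I (C.comp i c l)) y) (unit I r) := by
        rw [← unit_comp hk hcl, comp_lt_assoc hk (x := unit I c) (y := unit I l) hcl hly,
          comp_lt_assoc hk (x := unit I c) (y := comp i (unit I l) y)
            (by rw [hd, C.src_comp hk _ _ hly]; exact hcl) hlyr]
      rw [key]
      refine IsLayered.succ _ _ hk (fun hk' => ?_) hr ?_ hyr hy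
      · rw [C.src_comp_lt i.lt_succ_self hk' _ _ hcl, hc hk', hl hk']
      · rw [C.tgt_comp hk _ _ hcl, hly]

/-- Mirror image of `IsLayered.comp_left`; here the factor `c` itself goes to `l` and its `k`-target
to `y` and `r`. -/
theorem IsLayered.comp_right {x : Cells C Γ I} {k : ℕ} {y : Cells C Γ I}
    (hy : IsLayered x k y) :
    ∀ (i : ℕ) (c : C.Cell), i < k → (k < m → C.src k c = c) → C.tgt i (dom y) = C.src i c →
      IsLayered x k (comp i y (unit I c)) := by
  induction hy with
  | zero => exact fun i c hi => absurd hi (Nat.not_lt_zero i)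
  | @succ k y l r hk hl hr hly hyr hy ih =>
    intro i c hi hc h
    rw [(dom_layer hk hly hyr).1] at h
    have hd := (dom_comp_lt (x := unit I l) (y := y) hk hly).1
    rw [dom_unit] at hd
    have hlyr : C.tgt k (dom (comp k (unit I l) y)) = C.src k (dom (unit (Γ := Γ) I r)) := by
      rw [hd, C.tgt_comp hk _ _ hly, hyr]; rfl
    rcases Nat.lt_succ_iff_lt_or_eq.1 hi with hik | rfl
    · obtain ⟨-, a₀, a₁, a₂, a₃, a₄⟩ := src_lt_layer hik hk hly hyr
      have him := hik.trans hk
      rw [a₀] at h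
      have ht : C.tgt i (dom y) = C.src i (C.tgt k c) := by rw [C.src_tgt_lt hik hk, h]
      have hcl : C.tgt i l = C.src i c := by rw [a₂, h]
      have hcr : C.tgt i r = C.src i (C.tgt k c) := by rw [a₄, ht]
      have hcc : C.tgt k c = C.src k (C.tgt k c) := (C.src_tgt_le le_rfl hk c).symm
      have hdl : dom (comp i y (unit I (C.tgt k c))) = C.comp i (dom y) (C.tgt k c) :=
        (dom_comp_lt (y := unit I (C.tgt k c)) him ht).1
      have key : comp i (comp k (comp k (unit I l) y) (unit I r)) (unit I c) =
          comp k (comp k (unit I (C.comp i l c)) (comp i y (unit I (C.tgt k c))))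
            (unit I (C.comp i r (C.tgt k c))) := by
        rw [← unit_comp him hcl, ← unit_comp him hcr]
        rw [← interchange_lt hik hk (x := unit I l) (x' := y) (y := unit I c)
          (y' := unit I (C.tgt k c)) hly hcc hcl ht]
        rw [unit_comp hk hcc, C.tgt_unit hk]
        rw [← interchange_lt hik hk (x' := unit I r) (y := unit I c) (y' := unit I (C.tgt k c))
          hlyr hcc
          (by rw [hd, ← C.tgt_src_lt hik hk, C.src_comp hk _ _ hly, C.tgt_src_lt hik hk]
              exact hcl) hcr]
        rw [unit_comp hk hcc, C.tgt_unit hk]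
      rw [key]
      refine IsLayered.succ _ _ hk (fun hk' => ?_) (fun hk' => ?_) ?_ ?_
        (ih i (C.tgt k c) hik (fun _ => C.src_tgt_le le_rfl hk c) ht)
      · rw [C.src_comp_lt (hik.trans k.lt_succ_self) hk' _ _ hcl, hc hk', hl hk']
      · rw [C.src_comp_lt (hik.trans k.lt_succ_self) hk' _ _ hcr,
          C.src_tgt_le k.le_succ hk', hr hk']
      · rw [hdl, C.tgt_comp_lt hik hk _ _ hcl, C.src_comp_lt hik hk _ _ ht, hly,
          C.src_tgt_le le_rfl hk]
      · rw [hdl, C.tgt_comp_lt hik hk _ _ ht, C.src_comp_lt hik hk _ _ hcr, hyr,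
          C.src_tgt_le le_rfl hk, C.tgt_tgt_le le_rfl hk]
    · have hlyr' : C.tgt i (C.comp i l (dom y)) = C.src i r := by
        rw [C.tgt_comp hk _ _ hly, hyr]
      have hcr : C.tgt i r = C.src i c := by
        rw [← h, C.tgt_comp hk _ _ hlyr']
      have key : comp i (comp i (comp i (unit I l) y) (unit I r)) (unit I c) =
          comp i (comp i (unit I l) y) (unit I (C.comp i r c)) := by
        rw [← unit_comp hk hcr, comp_lt_assoc hk (z := unit I c) hlyr hcr]
      rw [key]
      refine IsLayered.succ _ _ hk hl (fun hk' => ?_) hly ?_ hy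
      · rw [C.src_comp_lt i.lt_succ_self hk' _ _ hcr, hc hk', hr hk']
      · rw [C.src_comp hk _ _ hcr, hyr]

end FreeExt

/-! ### From layers to whiskers -/

namespace Whisker

open FreeExt

variable {m : ℕ} {C : StrictNCat.{u} m} {Γ : CellExt C} {I : Γ.Gen → Γ.Gen → Prop}

theorem base_congr {W W' : Whisker C} {u : C.Cell} :
    ∀ {k : ℕ}, (∀ j < k, W.left j = W'.left j ∧ W.right j = W'.right j) →
      W.base u k = W'.base u k
  | 0, _ => rfl
  | k + 1, h => by
    change C.comp k (C.comp k (W.left k) (W.base u k)) (W.right k) =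
      C.comp k (C.comp k (W'.left k) (W'.base u k)) (W'.right k)
    rw [(h k k.lt_succ_self).1, (h k k.lt_succ_self).2,
      base_congr fun j hj => h j (hj.trans k.lt_succ_self)]

theorem layers_congr {W W' : Whisker C} {x : Cells C Γ I} :
    ∀ {k : ℕ}, (∀ j < k, W.left j = W'.left j ∧ W.right j = W'.right j) →
      W.layers x k = W'.layers x k
  | 0, _ => rfl
  | k + 1, h => by
    change FreeExt.comp k (FreeExt.comp k (unit I (W.left k)) (W.layers x k))
        (unit I (W.right k)) =
      FreeExt.comp k (FreeExt.comp k (unit I (W'.left k)) (W'.layers x k)) (unit I (W'.right k))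
    rw [(h k k.lt_succ_self).1, (h k k.lt_succ_self).2,
      layers_congr fun j hj => h j (hj.trans k.lt_succ_self)]

theorem layers_ends {W : Whisker C} {x : Cells C Γ I} :
    ∀ {k : ℕ}, k ≤ m → (∀ j < k, C.tgt j (W.left j) = C.src j (W.base (dom x) j) ∧
        C.tgt j (W.base (dom x) j) = C.src j (W.right j)) →
      dom (W.layers x k) = W.base (dom x) k ∧ cod (W.layers x k) = W.base (cod x) k
  | 0, _, _ => ⟨rfl, rfl⟩
  | k + 1, hk, h => by
    obtain ⟨h₁, h₂⟩ := layers_ends (W := W) (x := x) (Nat.le_of_succ_le hk)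
      fun j hj => h j (hj.trans k.lt_succ_self)
    have := h k k.lt_succ_self
    rw [← h₁] at this
    have key := dom_layer (I := I) hk this.1 this.2
    rw [h₁, h₂] at key
    exact key

/-- Replace the entries of a whisker at one index. -/
def update (W : Whisker C) (k : ℕ) (l r : C.Cell) (hl : k + 1 < m → C.src (k + 1) l = l)
    (hr : k + 1 < m → C.src (k + 1) r = r) : Whisker C where
  left := Function.update W.left k l
  right := Function.update W.right k r
  left_cell j hj := by
    rcases eq_or_ne j k with rfl | h
    · simpa using hl hj
    · simpa [h] using W.left_cell j hj
  right_cell j hj := by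
    rcases eq_or_ne j k with rfl | h
    · simpa using hr hj
    · simpa [h] using W.right_cell j hj

end Whisker

namespace FreeExt

variable {m : ℕ} {C : StrictNCat.{u} m} {Γ : CellExt C} {I : Γ.Gen → Γ.Gen → Prop}

/-- Each layer fixes one entry of the whisker without disturbing the layers inside it, which depend
on lower entries only. -/
theorem IsLayered.exists_whisker {x : Cells C Γ I} {k : ℕ} {y : Cells C Γ I}
    (hy : IsLayered x k y) (hk : k ≤ m) :
    ∃ W : Whisker C, (∀ j < k, C.tgt j (W.left j) = C.src j (W.base (dom x) j) ∧
      C.tgt j (W.base (dom x) j) = C.src j (W.right j)) ∧ W.layers x k = y := by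
  induction hy with
  -- No entry is constrained yet, so any whisker would serve.
  | zero => exact ⟨Whisker.trivial (dom x), fun j hj => absurd hj (Nat.not_lt_zero j), rfl⟩
  | @succ k y l r hk hl hr hly hyr hy ih =>
    obtain ⟨W, hW, rfl⟩ := ih (Nat.le_of_lt hk)
    have hne : ∀ j < k, (W.update k l r hl hr).left j = W.left j ∧
        (W.update k l r hl hr).right j = W.right j := fun j hj => by
      simp [Whisker.update, hj.ne]
    have hkl : (W.update k l r hl hr).left k = l ∧ (W.update k l r hl hr).right k = r := by
      simp [Whisker.update]
    refine ⟨W.update k l r hl hr, fun j hj => ?_, ?_⟩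
    · rcases Nat.lt_succ_iff_lt_or_eq.1 hj with hj | rfl
      · rw [(hne j hj).1, (hne j hj).2,
          Whisker.base_congr fun i hi => hne i (hi.trans hj)]
        exact hW j hj
      · rw [hkl.1, hkl.2, Whisker.base_congr hne,
          ← (Whisker.layers_ends (Nat.le_of_lt hk) hW).1]
        exact ⟨hly, hyr⟩
    · change comp k (comp k (unit I ((W.update k l r hl hr).left k))
        ((W.update k l r hl hr).layers x k)) (unit I ((W.update k l r hl hr).right k)) = _
      rw [hkl.1, hkl.2, Whisker.layers_congr hne]

end FreeExt

/-! ### Functoriality of whiskers -/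

namespace Whisker

open FreeExt

variable {m : ℕ} {C : StrictNCat.{u} m} {Γ : CellExt C} {I : Γ.Gen → Γ.Gen → Prop}

theorem Fits.layers_ends {W : Whisker C} {x : Cells C Γ I} (h : W.Fits (dom x)) {k : ℕ}
    (hk : k ≤ m) :
    dom (W.layers x k) = W.base (dom x) k ∧ cod (W.layers x k) = W.base (cod x) k :=
  Whisker.layers_ends hk fun j hj => h j (hj.trans_le hk)

theorem Fits.composable {W : Whisker C} {x : Cells C Γ I} (h : W.Fits (dom x)) {k : ℕ}
    (hk : k < m) : C.tgt k (W.left k) = C.src k (dom (W.layers x k)) ∧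
      C.tgt k (dom (W.layers x k)) = C.src k (W.right k) := by
  rw [(h.layers_ends (Nat.le_of_lt hk)).1]
  exact h k hk

theorem Fits.cod {W : Whisker C} {x : Cells C Γ I} (h : W.Fits (dom x)) :
    W.Fits (FreeExt.cod x) := by
  intro k hk
  rw [← (h.layers_ends (Nat.le_of_lt hk)).2, src_dom_cod hk, tgt_dom_cod hk]
  exact h.composable hk

theorem Fits.isLayered {W : Whisker C} {x : Cells C Γ I} (h : W.Fits (dom x)) :
    ∀ {k : ℕ}, k ≤ m → IsLayered x k (W.layers x k)
  | 0, _ => IsLayered.zero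
  | k + 1, hk => IsLayered.succ _ _ hk (W.left_cell k) (W.right_cell k) (h.composable hk).1
      (h.composable hk).2 (h.isLayered (Nat.le_of_succ_le hk))

/-- Whiskers are functorial for the top composition. -/
theorem layers_comp {W : Whisker C} {x y : Cells C Γ I} (h : W.Fits (dom x))
    (hxy : FreeExt.cod x = dom y) : ∀ {k : ℕ}, k ≤ m →
    W.layers (FreeExt.comp m x y) k = FreeExt.comp m (W.layers x k) (W.layers y k)
  | 0, _ => rfl
  | k + 1, hk => by
    have hy : W.Fits (dom y) := hxy ▸ h.cod
    have hk' := Nat.le_of_succ_le hk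
    have hl : FreeExt.cod (W.layers x k) = dom (W.layers y k) := by
      rw [(h.layers_ends hk').2, (hy.layers_ends hk').1, hxy]
    have hd := dom_comp_lt (x := unit I (W.left k)) hk (h.composable hk).1
    have hd' := dom_comp_lt (x := unit I (W.left k)) hk (hy.composable hk).1
    change FreeExt.comp k (FreeExt.comp k (unit I (W.left k))
      (W.layers (FreeExt.comp m x y) k)) (unit I (W.right k)) = _
    rw [layers_comp h hxy hk', comp_left_unit_comp hk (h.composable hk).1 hl,
      comp_comp_right_unit hk]
    · rfl
    · rw [hd.1, dom_unit, C.tgt_comp hk _ _ (h.composable hk).1]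
      exact (h.composable hk).2
    · rw [hd.2, hd'.1, hl]; rfl

theorem act_comp {W : Whisker C} {x y : Cells C Γ I} (h : W.Fits (dom x))
    (hxy : FreeExt.cod x = dom y) :
    W.act (FreeExt.comp m x y) = FreeExt.comp m (W.act x) (W.act y) :=
  layers_comp h hxy le_rfl

theorem dom_act {W : Whisker C} {x : Cells C Γ I} (h : W.Fits (dom x)) :
    dom (W.act x) = W.base (dom x) m := (h.layers_ends le_rfl).1

theorem cod_act {W : Whisker C} {x : Cells C Γ I} (h : W.Fits (dom x)) :
    FreeExt.cod (W.act x) = W.base (FreeExt.cod x) m := (h.layers_ends le_rfl).2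

end Whisker

/-! ### Steps are stable under whiskers -/

namespace FreeExt

variable {m : ℕ} {C : StrictNCat.{u} m} {Γ : CellExt C} {I : Γ.Gen → Γ.Gen → Prop}

theorem IsLayered.isStepOf {X : Set Γ.Gen} {γ : Γ.Gen} (hγ : γ ∈ X) {x : Cells C Γ I}
    (h : IsLayered (gen I γ) m x) : IsStepOf X x := by
  obtain ⟨W, hW, rfl⟩ := h.exists_whisker le_rfl
  exact ⟨γ, hγ, W, hW, rfl⟩

theorem IsStepOf.comp_left {X : Set Γ.Gen} {x : Cells C Γ I} (hx : IsStepOf X x) {i : ℕ}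
    (hi : i < m) {c : C.Cell} (h : C.tgt i c = C.src i (dom x)) :
    IsStepOf X (comp i (unit I c) x) := by
  obtain ⟨γ, hγ, W, hW, rfl⟩ := hx
  exact ((hW.isLayered (x := gen I γ) le_rfl).comp_left i c hi (fun h => absurd h (lt_irrefl m))
    h).isStepOf hγ

theorem IsStepOf.comp_right {X : Set Γ.Gen} {x : Cells C Γ I} (hx : IsStepOf X x) {i : ℕ}
    (hi : i < m) {c : C.Cell} (h : C.tgt i (dom x) = C.src i c) :
    IsStepOf X (comp i x (unit I c)) := by
  obtain ⟨γ, hγ, W, hW, rfl⟩ := hx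
  exact ((hW.isLayered (x := gen I γ) le_rfl).comp_right i c hi (fun h => absurd h (lt_irrefl m))
    h).isStepOf hγ

theorem IsStepOf.layers {X : Set Γ.Gen} {x : Cells C Γ I} (hx : IsStepOf X x) {W : Whisker C}
    (hW : W.Fits (dom x)) : ∀ {k : ℕ}, k ≤ m → IsStepOf X (W.layers x k)
  | 0, _ => hx
  | k + 1, hk => by
    have hc := hW.composable (k := k) hk
    refine ((hx.layers hW (Nat.le_of_succ_le hk)).comp_left hk hc.1).comp_right hk ?_
    rw [(dom_comp_lt (x := unit I (W.left k)) hk hc.1).1, dom_unit, C.tgt_comp hk _ _ hc.1]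
    exact hc.2

theorem IsStepOf.act {X : Set Γ.Gen} {x : Cells C Γ I} (hx : IsStepOf X x) {W : Whisker C}
    (hW : W.Fits (dom x)) : IsStepOf X (W.act x) := hx.layers hW le_rfl

theorem IsStepOf.isStep {X : Set Γ.Gen} {x : Cells C Γ I} (hx : IsStepOf X x) : IsStep x :=
  let ⟨γ, _, W, hW, h⟩ := hx
  ⟨γ, Set.mem_univ γ, W, hW, h⟩

/-! ### Decomposition into steps -/

/-- Sequential composites of steps. -/
inductive IsPath : Cells C Γ I → Prop
  | unit (c : C.Cell) : IsPath (unit I c)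
  | cons {x y : Cells C Γ I} (hx : IsStep x) (h : cod x = dom y) (hy : IsPath y) :
      IsPath (comp m x y)

theorem IsPath.of_isStep {x : Cells C Γ I} (hx : IsStep x) : IsPath x := by
  have := IsPath.cons hx rfl (IsPath.unit (cod x))
  rwa [comp_top_unit rfl] at this

theorem IsPath.comp {x y : Cells C Γ I} (hx : IsPath x) (hy : IsPath y) (h : cod x = dom y) :
    IsPath (comp m x y) := by
  induction hx with
  | unit c => rwa [unit_comp_top (c := c) h]
  | cons hx h' _ ih =>
    rw [cod_comp h'] at h
    rw [comp_top_assoc h' h]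
    exact IsPath.cons hx (by rw [dom_comp h, h']) (ih h)

theorem IsPath.comp_left {x : Cells C Γ I} (hx : IsPath x) {i : ℕ} (hi : i < m) {c : C.Cell}
    (h : C.tgt i c = C.src i (dom x)) : IsPath (FreeExt.comp i (FreeExt.unit I c) x) := by
  induction hx with
  | unit a => rw [unit_comp (b := a) hi h]; exact IsPath.unit _
  | @cons x y hx h' _ ih =>
    rw [dom_comp h'] at h
    have hy : C.tgt i c = C.src i (dom y) := by rw [← h', src_dom_cod hi, h]
    rw [comp_left_unit_comp hi h h']
    refine IsPath.cons (IsStepOf.comp_left hx hi h) ?_ (ih hy)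
    rw [(dom_comp_lt (x := FreeExt.unit I c) hi h).2,
      (dom_comp_lt (x := FreeExt.unit I c) hi hy).1, h']
    rfl

theorem IsPath.comp_right {x : Cells C Γ I} (hx : IsPath x) {i : ℕ} (hi : i < m) {c : C.Cell}
    (h : C.tgt i (dom x) = C.src i c) : IsPath (FreeExt.comp i x (FreeExt.unit I c)) := by
  induction hx with
  | unit a => rw [unit_comp (a := a) hi h]; exact IsPath.unit _
  | @cons x y hx h' _ ih =>
    rw [dom_comp h'] at h
    have hy : C.tgt i (dom y) = C.src i c := by rw [← h', tgt_dom_cod hi, h]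
    rw [comp_comp_right_unit hi h h']
    refine IsPath.cons (IsStepOf.comp_right hx hi h) ?_ (ih hy)
    rw [(dom_comp_lt (y := FreeExt.unit I c) hi h).2,
      (dom_comp_lt (y := FreeExt.unit I c) hi hy).1, h']
    rfl

/-- Every cell is a sequential composite of steps. -/
theorem isPath (x : Cells C Γ I) : IsPath x := by
  induction x using ind with
  | h a b x =>
    induction x with
    | base c => exact IsPath.unit c
    | gen γ => exact IsPath.of_isStep (isStep_gen γ)
    | top x y h ihx ihy =>
      rw [← comp_mk_top x y h]
      exact ihx.comp ihy h
    | @comp a b a' b' i hi x y h ihx ihy =>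
      have h' : C.tgt i b = C.src i a' := by rw [← (x.parallel i hi).2, h]
      -- Interchange makes a composite in low dimension sequential: the left factor acts first, then
      -- the right one, each whiskered by an identity.
      rw [← comp_mk_lt hi x y h, comp_lt_eq_left_right hi h]
      refine (ihx.comp_right hi h).comp (ihy.comp_left hi h') ?_
      exact (dom_comp_lt (x := mk I x) (y := FreeExt.unit I a') hi h).2.trans
        (dom_comp_lt (x := FreeExt.unit I b) (y := mk I y) hi h').1.symm

/-! ### Weights -/

/-- The sum of the weights of the generators in a formal composite. -/
def exprWeight (w : Γ.Gen → ℕ) : ∀ {a b : C.Cell}, CellExpr C Γ a b → ℕ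
  | _, _, CellExpr.base _ => 0
  | _, _, CellExpr.gen γ => w γ
  | _, _, CellExpr.top x y _ => exprWeight w x + exprWeight w y
  | _, _, CellExpr.comp _ _ x y _ => exprWeight w x + exprWeight w y

/-- The axioms of higher categories preserve the generators with their multiplicities; only the
relations `γ ⋆ₘ δ = 1` cancel some, whence the condition on `I`. -/
theorem exprWeight_rel (w : Γ.Gen → ℕ) (hI : ∀ γ δ, ¬ I γ δ) {a b a' b' : C.Cell}
    {x : CellExpr C Γ a b} {y : CellExpr C Γ a' b'} (h : CellRel C Γ I x y) :
    exprWeight w x = exprWeight w y := by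
  induction h with
  | refl x => rfl
  | symm _ ih => exact ih.symm
  | trans _ _ ih ih' => exact ih.trans ih'
  | top_congr h h' _ _ ih ih' => simp only [exprWeight, ih, ih']
  | comp_congr i hi h h' _ _ ih ih' => simp only [exprWeight, ih, ih']
  | inverse γ δ h h' h'' => exact absurd h'' (hI γ δ)
  | _ => simp only [exprWeight]; try omega

/-- The sum of the weights of the generators in a cell of a free category. -/
def weight (w : Γ.Gen → ℕ) (x : Γ.FreeCells) : ℕ :=
  Quotient.lift (s := setoid C Γ _) (fun t => exprWeight w t.expr)
    (fun _ _ h => exprWeight_rel w (fun _ _ => id) h) x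

theorem weight_unit (w : Γ.Gen → ℕ) (c : C.Cell) : weight w (unit _ c) = 0 := rfl

theorem weight_gen (w : Γ.Gen → ℕ) (γ : Γ.Gen) : weight w (gen _ γ) = w γ := rfl

theorem weight_comp_top (w : Γ.Gen → ℕ) {x y : Γ.FreeCells} (h : cod x = dom y) :
    weight w (comp m x y) = weight w x + weight w y := by
  induction x using ind with
  | h a b x =>
    induction y using ind with
    | h a' b' y => rw [comp_mk_top x y h]; rfl

theorem weight_comp_lt (w : Γ.Gen → ℕ) {i : ℕ} (hi : i < m) {x y : Γ.FreeCells}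
    (h : C.tgt i (dom x) = C.src i (dom y)) :
    weight w (comp i x y) = weight w x + weight w y := by
  induction x using ind with
  | h a b x =>
    induction y using ind with
    | h a' b' y => rw [comp_mk_lt hi x y h]; rfl

theorem weight_layers (w : Γ.Gen → ℕ) {W : Whisker C} {x : Γ.FreeCells} (h : W.Fits (dom x)) :
    ∀ {k : ℕ}, k ≤ m → weight w (W.layers x k) = weight w x
  | 0, _ => rfl
  | k + 1, hk => by
    have hc := h.composable (k := k) hk
    change weight w (comp k (comp k (unit _ (W.left k)) (W.layers x k)) (unit _ (W.right k))) = _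
    rw [weight_comp_lt w hk, weight_comp_lt w hk (x := unit _ (W.left k)) hc.1,
      weight_layers w h (Nat.le_of_succ_le hk), weight_unit, weight_unit, zero_add, add_zero]
    rw [(dom_comp_lt (x := unit _ (W.left k)) hk hc.1).1, dom_unit, C.tgt_comp hk _ _ hc.1]
    exact hc.2

theorem weight_act (w : Γ.Gen → ℕ) {W : Whisker C} {x : Γ.FreeCells} (h : W.Fits (dom x)) :
    weight w (W.act x) = weight w x := weight_layers w h le_rfl

/-- The number of generators in a cell of a free category. -/
def size (x : Γ.FreeCells) : ℕ := weight (fun _ => 1) x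

/-- A formal composite without generators is built from cells of `C` alone, and the relations
evaluate it there. -/
theorem isIdentity_of_size_eq_zero {x : Γ.FreeCells} (hx : size x = 0) : IsIdentity x := by
  have key : ∀ {a b : C.Cell} (x : CellExpr C Γ a b), exprWeight (fun _ => 1) x = 0 →
      CellRel C Γ (fun _ _ => False) x (CellExpr.base a) := by
    intro a b x
    induction x with
    | base c => exact fun _ => CellRel.refl _
    | gen γ => exact fun h => absurd h one_ne_zero
    | @top a b b' c x y h ihx ihy =>
      intro hw
      simp only [exprWeight, Nat.add_eq_zero_iff] at hw
      have h₁ := ihx hw.1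
      have h₂ := ihy hw.2
      have hab : b = a := h₁.ends.2
      exact (CellRel.top_congr h (hab.symm.trans h) h₁ h₂).trans
        (((CellRel.top_unit_left _ _).trans (by
          rw [← hab, h]
          exact CellRel.refl _)))
    | comp i hi x y h ihx ihy =>
      intro hw
      simp only [exprWeight, Nat.add_eq_zero_iff] at hw
      exact (CellRel.comp_congr i hi h h (ihx hw.1) (ihy hw.2)).trans
        (CellRel.comp_base _ _ i hi h)
  induction x using ind with
  | h a b x => exact mk_eq (key x hx)

theorem IsIdentity.weight {x : Γ.FreeCells} (hx : IsIdentity x) (w : Γ.Gen → ℕ) :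
    weight w x = 0 := by
  rw [hx]; rfl

theorem IsStepOf.weight {X : Set Γ.Gen} {x : Γ.FreeCells} (hx : IsStepOf X x) (w : Γ.Gen → ℕ)
    {a : ℕ} (hw : ∀ γ ∈ X, w γ = a) : weight w x = a := by
  obtain ⟨γ, hγ, W, hW, rfl⟩ := hx
  rw [weight_act w hW, weight_gen, hw γ hγ]

theorem IsStep.size {x : Γ.FreeCells} (hx : IsStep x) : size x = 1 :=
  IsStepOf.weight hx _ fun _ _ => rfl

theorem IsStep.not_isIdentity {x : Γ.FreeCells} (hx : IsStep x) : ¬ IsIdentity x := fun h => by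
  have := hx.size
  rw [FreeExt.size, h.weight] at this
  exact zero_ne_one this

/-! ### Inverses -/

theorem IsInverse.symm {x y : Cells C Γ I} (h : IsInverse x y) : IsInverse y x :=
  ⟨h.2.1, h.1, h.2.2.2, h.2.2.1⟩

theorem isInverse_unit (c : C.Cell) : IsInverse (unit (Γ := Γ) I c) (unit I c) :=
  ⟨rfl, rfl, unit_comp_top (x := unit I c) rfl, unit_comp_top (x := unit I c) rfl⟩

theorem IsInverse.comp_top {x x' y y' : Cells C Γ I} (hx : IsInverse x x') (hy : IsInverse y y')
    (h : cod x = dom y) : IsInverse (comp m x y) (comp m y' x') := by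
  -- One of the two inverse laws suffices: the other is the same statement for the inverses.
  have aux : ∀ {x x' y y' : Cells C Γ I}, IsInverse x x' → IsInverse y y' → cod x = dom y →
      comp m (comp m x y) (comp m y' x') = unit I (dom x) := by
    intro x x' y y' hx hy h
    have hx₁ := hx.1
    have hy₁ := hy.1
    have hy₂ := hy.2.1
    have h' : cod y' = dom x' := by rw [hy₂, ← h, hx₁]
    rw [comp_top_assoc h (by rw [dom_comp h', hy₁]), ← comp_top_assoc hy₁ h', hy.2.2.1,
      unit_comp_top (by rw [← h, hx₁]), hx.2.2.1]
  have h' : cod y' = dom x' := by rw [hy.2.1, ← h, hx.1]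
  refine ⟨?_, ?_, ?_, ?_⟩
  · rw [cod_comp h, dom_comp h', hy.1]
  · rw [cod_comp h', dom_comp h, hx.2.1]
  · rw [aux hx hy h, dom_comp h]
  · rw [aux hy.symm hx.symm h', dom_comp h']

theorem IsInverse.comp_lt {i : ℕ} (hi : i < m) {x x' y y' : Cells C Γ I} (hx : IsInverse x x')
    (hy : IsInverse y y') (h : C.tgt i (dom x) = C.src i (dom y)) :
    IsInverse (comp i x y) (comp i x' y') := by
  have h' : C.tgt i (dom x') = C.src i (dom y') := by
    rw [← hx.1, ← hy.1, tgt_dom_cod hi, src_dom_cod hi, h]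
  have d := dom_comp_lt hi h
  have hd' := dom_comp_lt hi h'
  refine ⟨?_, ?_, ?_, ?_⟩
  · rw [d.2, hd'.1, hx.1, hy.1]
  · rw [d.1, hd'.2, hx.2.1, hy.2.1]
  · rw [← interchange_top hi hx.1 hy.1 h, hx.2.2.1, hy.2.2.1, unit_comp hi h, d.1]
  · rw [← interchange_top hi hx.2.1 hy.2.1 h', hx.2.2.2, hy.2.2.2, unit_comp hi h',
      hd'.1]

/-- The cells of a free `(m+1,m)`-category are invertible. -/
theorem exists_isInverse {E : CellExt C} (x : E.InvCells) : ∃ y, IsInverse x y := by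
  induction x using ind with
  | h a b x =>
    induction x with
    | base c => exact ⟨_, isInverse_unit c⟩
    | gen γ =>
      obtain ⟨γ, s⟩ := γ
      have h₁ : E.signed.t (γ, s) = E.signed.s (γ, !s) := by cases s <;> rfl
      have h₂ : E.signed.t (γ, !s) = E.signed.s (γ, s) := by cases s <;> rfl
      refine ⟨gen _ (γ, !s), h₁, h₂, ?_, ?_⟩
      · exact (comp_mk_top _ _ h₁).trans
          (mk_eq (CellRel.inverse (Γ := E.signed) _ _ h₁ h₂ ⟨rfl, by cases s <;> simp⟩))
      · exact (comp_mk_top _ _ h₂).trans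
          (mk_eq (CellRel.inverse (Γ := E.signed) _ _ h₂ h₁ ⟨rfl, by cases s <;> simp⟩))
    | top x y h ihx ihy =>
      obtain ⟨x', hx⟩ := ihx
      obtain ⟨y', hy⟩ := ihy
      rw [← comp_mk_top x y h]
      exact ⟨_, hx.comp_top hy h⟩
    | comp i hi x y h ihx ihy =>
      obtain ⟨x', hx⟩ := ihx
      obtain ⟨y', hy⟩ := ihy
      rw [← comp_mk_lt hi x y h]
      exact ⟨_, hx.comp_lt hi hy h⟩

end FreeExt

/-! ### Numbers of generators in free categories on polygraphs -/

/-- A count `len k x` of the generating `(k+1)`-cells in the `(k+1)`-source of `x`. -/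
structure Grading {n : ℕ} (C : StrictNCat.{u} n) where
  len : ℕ → C.Cell → ℕ
  len_comp : ∀ {i k : ℕ}, i ≤ k → k < n → ∀ x y, C.tgt i x = C.src i y →
    len k (C.comp i x y) = len k x + len k y
  src_eq_self : ∀ {k : ℕ}, k + 1 = n → ∀ x, len k x = 0 → C.src k x = x
  src_eq_src : ∀ {k : ℕ}, k + 1 < n → ∀ x, len k x = 0 → C.src (k + 1) x = C.src k x

namespace Grading

/-- The trivial grading of a set. -/
def discrete (X : Type u) : Grading (StrictNCat.discrete X) where
  len _ _ := 0
  len_comp _ h := absurd h (Nat.not_lt_zero _)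
  src_eq_self h := absurd h (Nat.succ_ne_zero _)
  src_eq_src h := absurd h (Nat.not_lt_zero _)

open FreeExt in
/-- A grading of a category extends to the free extensions. -/
noncomputable def free {m : ℕ} {C : StrictNCat.{u} m} (G : Grading C) (Γ : CellExt C) :
    Grading Γ.freeCat where
  len k x := if k < m then G.len k (dom (I := fun _ _ => False) x)
    else size (show Γ.FreeCells from x)
  len_comp {i k} hik hk x y h := by
    rcases Nat.lt_succ_iff_lt_or_eq.1 hk with hk | rfl
    · have him := hik.trans_lt hk
      have h' := composable_lt (I := fun _ _ => False) him h
      simp only [hk, if_true]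
      exact (congrArg (G.len k) (dom_comp_lt him h').1).trans (G.len_comp hik hk _ _ h')
    · simp only [lt_irrefl, if_false]
      rcases hik.lt_or_eq with hik | rfl
      · exact weight_comp_lt _ hik (composable_lt (I := fun _ _ => False) hik h)
      · exact weight_comp_top _ (composable_top (I := fun _ _ => False) h)
  src_eq_self {k} hk x h := by
    obtain rfl : k = m := Nat.succ_injective hk
    simp only [lt_irrefl, if_false] at h
    exact (src_top (I := fun _ _ => False) x).trans (isIdentity_of_size_eq_zero h).symm
  src_eq_src {k} hk x h := by
    have hk' : k < m := Nat.lt_of_succ_lt_succ hk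
    simp only [hk', if_true] at h
    refine Eq.trans ?_ (src_lt (I := fun _ _ => False) hk' x).symm
    rcases Nat.lt_or_eq_of_le (Nat.succ_le_of_lt hk') with hk'' | rfl
    · exact (src_lt (I := fun _ _ => False) hk'' x).trans
        (congrArg (unit _) (G.src_eq_src hk'' _ h))
    · exact (src_top (I := fun _ _ => False) x).trans
        (congrArg (unit _) (G.src_eq_self rfl _ h).symm)

/-- The free category on a polygraph is a tower of free extensions over a set, and `Grading.free`
climbs it one dimension at a time. -/
theorem nonempty_polygraph : ∀ {n : ℕ} (P : Polygraph.{u} n), Nonempty (Grading P.free)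
  | 0, P => ⟨discrete (show Type u from P)⟩
  | n + 1, P => by
    obtain ⟨Q, Γ⟩ : Σ P : (polygraphData n).1, CellExt ((polygraphData n).2 P) := P
    obtain ⟨G⟩ := nonempty_polygraph (n := n) Q
    exact ⟨free (C := (polygraphData n).2 Q) G Γ⟩

variable {m : ℕ} {C : StrictNCat.{u} m} (G : Grading C)

/-- The numbers of generators in each dimension, ordered with the highest dimension first. -/
def measure (x : C.Cell) : Colex (Fin m → ℕ) := toColex fun k => G.len k x

variable {G}

/-- The highest index at which the counts differ decides the comparison; by hypothesis it is at
least `k`, and there `x` has the smaller count. -/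
theorem measure_lt {x y : C.Cell} {k : ℕ} (hk : k < m)
    (h : ∀ j, k < j → j < m → G.len j x ≤ G.len j y) (hlt : G.len k x < G.len k y) :
    G.measure x < G.measure y := by
  refine lt_of_not_ge fun hle => ?_
  rcases hle.lt_or_eq with ⟨i, hi, hi'⟩ | heq
  · rcases lt_trichotomy (i : ℕ) k with hik | hik | hik
    · exact hlt.ne' (hi ⟨k, hk⟩ hik)
    · subst hik
      exact lt_asymm hlt hi'
    · exact (h i hik i.2).not_gt hi'
  · exact hlt.ne' (congrFun (toColex.injective heq) ⟨k, hk⟩)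

/-- Adding one layer of a whisker increases the measure, unless the layer is trivial. -/
theorem measure_layer {k : ℕ} (hk : k < m) {l u r : C.Cell}
    (hl : k + 1 < m → C.src (k + 1) l = l) (hr : k + 1 < m → C.src (k + 1) r = r)
    (hlu : C.tgt k l = C.src k u) (hur : C.tgt k u = C.src k r) :
    G.measure u < G.measure (C.comp k (C.comp k l u) r) ∨
      l = C.src k u ∧ r = C.tgt k u := by
  have hc : C.tgt k (C.comp k l u) = C.src k r := by rw [C.tgt_comp hk _ _ hlu, hur]
  have hlen : ∀ j, k ≤ j → j < m →
      G.len j (C.comp k (C.comp k l u) r) = G.len j l + G.len j u + G.len j r := fun j hj hjm => by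
    rw [G.len_comp hj hjm _ _ hc, G.len_comp hj hjm _ _ hlu]
  -- A `(k+1)`-cell that contains no generating `(k+1)`-cell is the identity of its `k`-source. For
  -- `k + 1 = m` every cell is a `(k+1)`-cell.
  have hid : ∀ x, (k + 1 < m → C.src (k + 1) x = x) → G.len k x = 0 → C.src k x = x := by
    intro x hx h
    rcases Nat.lt_or_eq_of_le (Nat.succ_le_of_lt hk) with hk' | hk'
    · rw [← G.src_eq_src hk' x h, hx hk']
    · exact G.src_eq_self hk' x h
  by_cases h : G.len k l = 0 ∧ G.len k r = 0
  · right
    have h₁ := hid l hl h.1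
    have h₂ := hid r hr h.2
    refine ⟨?_, by rw [hur, h₂]⟩
    rw [← hlu, ← h₁, C.tgt_src_le le_rfl hk]
  · left
    -- Below `k` the counts may drop, because the `k`-source of the composite is that of `l` rather
    -- than that of `u`; this is why the highest dimension is compared first.
    refine measure_lt hk (fun j hj hjm => ?_) ?_
    · rw [hlen j hj.le hjm]; omega
    · rw [hlen k le_rfl hk]; omega

/-- Either some layer is nontrivial and increases the measure, which later layers never decrease, or
every layer is trivial and the `m`-cell remains `u` throughout. -/
theorem measure_base {W : Whisker C} {u : C.Cell} (hW : W.Fits u) :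
    ∀ {k : ℕ}, k ≤ m → G.measure u < G.measure (W.base u k) ∨
      W.base u k = u ∧ ∀ j < k, W.left j = C.src j u ∧ W.right j = C.tgt j u
  | 0, _ => Or.inr ⟨rfl, fun j hj => absurd hj (Nat.not_lt_zero j)⟩
  | k + 1, hk => by
    have hl := measure_layer (G := G) hk (W.left_cell k) (W.right_cell k) (hW k hk).1 (hW k hk).2
    rcases measure_base hW (Nat.le_of_succ_le hk) with h | ⟨h, h'⟩
    · rcases hl with hl | hl
      · exact Or.inl (h.trans hl)
      · left
        change _ < G.measure (C.comp k (C.comp k (W.left k) (W.base u k)) (W.right k))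
        rwa [hl.1, hl.2, C.src_unit hk, C.tgt_unit hk]
    · rcases hl with hl | hl
      · rw [h] at hl
        left
        change _ < G.measure (C.comp k (C.comp k (W.left k) (W.base u k)) (W.right k))
        rwa [h]
      · right
        rw [h] at hl
        refine ⟨?_, fun j hj => ?_⟩
        · change C.comp k (C.comp k (W.left k) (W.base u k)) (W.right k) = u
          rw [h, hl.1, hl.2, C.src_unit hk, C.tgt_unit hk]
        · rcases Nat.lt_succ_iff_lt_or_eq.1 hj with hj | rfl
          · exact h' j hj
          · exact hl

end Grading

/-- A whisker whose entries are those of the trivial whisker around `u` acts trivially on the cells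
parallel to `u`. -/
theorem Whisker.act_eq_self {m : ℕ} {C : StrictNCat.{u} m} {Γ : CellExt C}
    {I : Γ.Gen → Γ.Gen → Prop} {W : Whisker C} {u : C.Cell} {x : FreeExt.Cells C Γ I}
    (hW : ∀ j < m, W.left j = C.src j u ∧ W.right j = C.tgt j u)
    (hs : ∀ j < m, C.src j (FreeExt.dom x) = C.src j u)
    (ht : ∀ j < m, C.tgt j (FreeExt.dom x) = C.tgt j u) : W.act x = x := by
  have : W.layers x m = (Whisker.trivial (FreeExt.dom x)).layers x m :=
    Whisker.layers_congr fun j hj =>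
      ⟨(hW j hj).1.trans (hs j hj).symm, (hW j hj).2.trans (ht j hj).symm⟩
  exact this.trans (Whisker.trivial_layers x m le_rfl)

/-! ### The order on branchings decreases the measure -/

namespace Branching

open FreeExt

variable {m : ℕ} {P : PolygraphModulo.{u} m}

theorem ext_of_eq {b b' : Branching P} (hf : b.f = b'.f) (he : b.e = b'.e) (hg : b.g = b'.g) :
    b = b' := by
  cases b; cases b'; cases hf; cases he; cases hg; rfl

/-- A branching strictly below another one has a source of smaller measure. -/
theorem Sub.measure_lt_or_eq (G : Grading P.base.free) {b b' : Branching P} (h : b'.Sub b) :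
    G.measure (dom b'.f) < G.measure (dom b.f) ∨ b' = b := by
  obtain ⟨W, hW, hf, he, hg⟩ := h
  have hd : dom b.f = W.base (dom b'.f) m := by rw [← hf, Whisker.dom_act hW]
  rcases Grading.measure_base (G := G) hW le_rfl with h | ⟨-, h⟩
  · left; rwa [hd]
  · right
    refine ext_of_eq ?_ ?_ ?_
    · rw [← hf, Whisker.act_eq_self h (fun _ _ => rfl) (fun _ _ => rfl)]
    -- The three cells of a branching are parallel in dimensions below `m`, so a whisker with
    -- trivial entries around one of them fixes all three.
    · rw [← he, Whisker.act_eq_self h (fun _ _ => by rw [b'.dom_f]) (fun _ _ => by rw [b'.dom_f])]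
    · rw [← hg, Whisker.act_eq_self h
        (fun j hj => by rw [b'.dom_g, src_dom_cod hj, b'.dom_f])
        (fun j hj => by rw [b'.dom_g, tgt_dom_cod hj, b'.dom_f])]

end Branching

/-! ### Boundaries of square cells -/

open FreeExt in
/-- `(f, g, e, d)` is the boundary of a square cell. -/
structure BoundsSquare {m : ℕ} {P : PolygraphModulo.{u} m} (Γ : SquareExt P) (f g : P.HCell)
    (e d : P.VCell) : Prop where
  dom_left : dom e = dom f
  cod_left : cod e = dom g
  dom_right : dom d = cod f
  cod_right : cod d = cod g
  cell : Nonempty (SquareCell Γ f g e d)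

namespace BoundsSquare

open FreeExt

variable {m : ℕ} {P : PolygraphModulo.{u} m} {Γ : SquareExt P}

theorem idH (f : P.HCell) : BoundsSquare Γ f f (P.vid (dom f)) (P.vid (cod f)) :=
  ⟨rfl, rfl, rfl, rfl, ⟨SquareCell.idH f⟩⟩

theorem idV (e : P.VCell) : BoundsSquare Γ (P.hid (dom e)) (P.hid (cod e)) e e :=
  ⟨rfl, rfl, rfl, rfl, ⟨SquareCell.idV e⟩⟩

theorem compV {f g f' g' : P.HCell} {e d c : P.VCell} (A : BoundsSquare Γ f g e d)
    (B : BoundsSquare Γ f' g' d c) : BoundsSquare Γ (comp m f f') (comp m g g') e c := by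
  have hf : cod f = dom f' := by rw [← A.dom_right, B.dom_left]
  have hg : cod g = dom g' := by rw [← A.cod_right, B.cod_left]
  refine ⟨?_, ?_, ?_, ?_, A.cell.elim fun A => B.cell.elim fun B => ⟨A.compV B⟩⟩
  · rw [dom_comp hf, A.dom_left]
  · rw [dom_comp hg, A.cod_left]
  · rw [cod_comp hf, B.dom_right]
  · rw [cod_comp hg, B.cod_right]

theorem compH {f g h : P.HCell} {e e' d d' : P.VCell} (A : BoundsSquare Γ f g e e')
    (B : BoundsSquare Γ g h d d') : BoundsSquare Γ f h (comp m e d) (comp m e' d') := by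
  have he : cod e = dom d := by rw [A.cod_left, B.dom_left]
  have he' : cod e' = dom d' := by rw [A.cod_right, B.dom_right]
  refine ⟨?_, ?_, ?_, ?_, A.cell.elim fun A => B.cell.elim fun B => ⟨A.compH B⟩⟩
  · rw [dom_comp he, A.dom_left]
  · rw [cod_comp he, B.cod_left]
  · rw [dom_comp he', A.dom_right]
  · rw [cod_comp he', B.cod_right]

theorem invH {f g : P.HCell} {e e' d d' : P.VCell} (A : BoundsSquare Γ f g e e')
    (h : IsInverse e d) (h' : IsInverse e' d') : BoundsSquare Γ g f d d' := by
  refine ⟨?_, ?_, ?_, ?_, A.cell.elim fun A => ⟨A.invH h h'⟩⟩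
  · rw [← h.1, A.cod_left]
  · rw [h.2.1, A.dom_left]
  · rw [← h'.1, A.cod_right]
  · rw [h'.2.1, A.dom_right]

theorem star {i : ℕ} (hi : i < m) {f g f' g' : P.HCell} {e d e' d' : P.VCell}
    (A : BoundsSquare Γ f g e d) (B : BoundsSquare Γ f' g' e' d')
    (h : P.base.free.tgt i (dom f) = P.base.free.src i (dom f')) :
    BoundsSquare Γ (comp i f f') (comp i g g') (comp i e e') (comp i d d') := by
  have he : P.base.free.tgt i (dom e) = P.base.free.src i (dom e') := by
    rw [A.dom_left, B.dom_left, h]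
  have hd : P.base.free.tgt i (dom d) = P.base.free.src i (dom d') := by
    rw [A.dom_right, B.dom_right, tgt_dom_cod hi, src_dom_cod hi, h]
  have hg : P.base.free.tgt i (dom g) = P.base.free.src i (dom g') := by
    rw [← A.cod_left, ← B.cod_left, tgt_dom_cod hi, src_dom_cod hi, he]
  refine ⟨?_, ?_, ?_, ?_, A.cell.elim fun A => B.cell.elim fun B => ⟨A.star i hi B h⟩⟩
  · rw [(dom_comp_lt hi he).1, (dom_comp_lt hi h).1, A.dom_left, B.dom_left]
  · rw [(dom_comp_lt hi he).2, (dom_comp_lt hi hg).1, A.cod_left, B.cod_left]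
  · rw [(dom_comp_lt hi hd).1, (dom_comp_lt hi h).2, A.dom_right, B.dom_right]
  · rw [(dom_comp_lt hi hd).2, (dom_comp_lt hi hg).2, A.cod_right, B.cod_right]

theorem layers {f g : P.HCell} {e d : P.VCell} (A : BoundsSquare Γ f g e d)
    {W : Whisker P.base.free} (hW : W.Fits (dom f)) :
    ∀ {k : ℕ}, k ≤ m →
      BoundsSquare Γ (W.layers f k) (W.layers g k) (W.layers e k) (W.layers d k)
  | 0, _ => A
  | k + 1, hk => by
    have hc := hW.composable (k := k) hk
    -- An `m`-cell acts on squares as the identity square on its identity horizontal cell.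
    refine ((idH (P.hid (W.left k))).star hk (A.layers hW (Nat.le_of_succ_le hk)) hc.1).star hk
      (idH (P.hid (W.right k))) ?_
    rw [(dom_comp_lt (x := P.hid (W.left k)) hk hc.1).1, dom_unit, P.base.free.tgt_comp hk _ _ hc.1]
    exact hc.2

/-- Whiskering of squares. -/
theorem act {f g : P.HCell} {e d : P.VCell} (A : BoundsSquare Γ f g e d) {W : Whisker P.base.free}
    (hW : W.Fits (dom f)) : BoundsSquare Γ (W.act f) (W.act g) (W.act e) (W.act d) :=
  A.layers hW le_rfl

end BoundsSquare

/-! ### Reduction of test branchings to critical ones -/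

namespace Branching

open FreeExt

variable {m : ℕ} {P : PolygraphModulo.{u} m} {Γ : SquareExt P}

theorem gammaConfluent_iff {b : Branching P} : b.GammaConfluent Γ ↔
    ∃ f' g' e', cod b.f = dom f' ∧ cod b.g = dom g' ∧
      BoundsSquare Γ (comp m b.f f') (comp m b.g g') b.e e' := by
  constructor
  · rintro ⟨f', g', e', hf, hg, hf', hg', hA⟩
    refine ⟨f', g', e', hf, hg, ?_, ?_, ?_, ?_, hA⟩
    · rw [dom_comp hf, b.dom_f]
    · rw [dom_comp hg, b.dom_g]
    · rw [cod_comp hf, hf']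
    · rw [cod_comp hg, hg']
  · rintro ⟨f', g', e', hf, hg, hA⟩
    refine ⟨f', g', e', hf, hg, ?_, ?_, hA.cell⟩
    · rw [hA.dom_right, cod_comp hf]
    · rw [hA.cod_right, cod_comp hg]

/-- Whiskers preserve squares and are functorial for `⋆ₘ`, so the whole confluence diagram can be
whiskered. -/
theorem GammaConfluent.of_sub {b b' : Branching P} (h : b'.GammaConfluent Γ) (hb : b'.Sub b) :
    b.GammaConfluent Γ := by
  obtain ⟨W, hW, hf, he, hg⟩ := hb
  obtain ⟨f', g', e', hf', hg', hA⟩ := gammaConfluent_iff.1 h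
  have hWf : W.Fits (dom f') := hf' ▸ hW.cod
  have hWe : W.Fits (dom b'.e) := b'.dom_f ▸ hW
  have hWg : W.Fits (dom b'.g) := b'.dom_g ▸ hWe.cod
  have hWg' : W.Fits (dom g') := hg' ▸ hWg.cod
  have key := hA.act (W := W) (by rwa [dom_comp hf'])
  rw [Whisker.act_comp hW hf', Whisker.act_comp hWg hg', hf, he, hg] at key
  refine gammaConfluent_iff.2 ⟨W.act f', W.act g', W.act e', ?_, ?_, key⟩
  · rw [← hf, Whisker.cod_act hW, Whisker.dom_act hWf, hf']
  · rw [← hg, Whisker.cod_act hWg, Whisker.dom_act hWg', hg']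

theorem IsAspherical.gammaConfluent {b : Branching P} (h : b.IsAspherical) :
    b.GammaConfluent Γ := by
  refine gammaConfluent_iff.2 ⟨P.hid (cod b.f), P.hid (cod b.g), P.vid (cod b.f), rfl, rfl, ?_⟩
  rw [comp_top_unit rfl, comp_top_unit rfl, h.1, ← b.dom_f, ← h.2]
  exact BoundsSquare.idH b.f

/-- Interchange completes both branches to the same cell `f ⋆ᵢ g`, and its identity square closes
the diagram. -/
theorem IsPeiffer.gammaConfluent {b : Branching P} (h : b.IsPeiffer) : b.GammaConfluent Γ := by
  obtain ⟨he, i, hi, f, g, -, -, hfg, h⟩ := h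
  have h₁ : P.base.free.tgt i (cod f) = P.base.free.src i (dom g) := by
    rw [tgt_dom_cod hi, hfg]
  have h₂ : P.base.free.tgt i (dom f) = P.base.free.src i (cod g) := by
    rw [src_dom_cod hi, hfg]
  have d₁ := dom_comp_lt (x := f) (y := P.hid (dom g)) hi hfg
  have d₂ := dom_comp_lt (x := P.hid (dom f)) (y := g) hi hfg
  have d₃ := dom_comp_lt (x := P.hid (cod f)) (y := g) hi h₁
  have d₄ := dom_comp_lt (x := f) (y := P.hid (cod g)) hi h₂
  have key : BoundsSquare Γ (comp i f g) (comp i f g) b.e (P.vid (cod (comp i f g))) := by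
    have : b.e = P.vid (dom (comp i f g)) := by
      rw [he, ← b.dom_f, (dom_comp_lt hi hfg).1]
      rcases h with h | h
      · rw [h.1, d₁.1]; rfl
      · rw [h.2, d₂.1]; rfl
    rw [this]
    exact BoundsSquare.idH _
  have e₁ := comp_lt_eq_left_right hi hfg
  have e₂ := comp_lt_eq_right_left hi hfg
  have c₁ : cod (comp i f (P.hid (dom g))) = dom (comp i (P.hid (cod f)) g) := by
    rw [d₁.2, d₃.1]; rfl
  have c₂ : cod (comp i (P.hid (dom f)) g) = dom (comp i f (P.hid (cod g))) := by
    rw [d₂.2, d₄.1]; rfl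
  rw [gammaConfluent_iff]
  rcases h with ⟨hf, hg⟩ | ⟨hg, hf⟩
  · refine ⟨comp i (P.hid (cod f)) g, comp i f (P.hid (cod g)), P.vid (cod (comp i f g)),
      by rw [hf, c₁], by rw [hg, c₂], ?_⟩
    rw [hf, hg]
    exact e₁ ▸ e₂ ▸ key
  · refine ⟨comp i f (P.hid (cod g)), comp i (P.hid (cod f)) g, P.vid (cod (comp i f g)),
      by rw [hf, c₂], by rw [hg, c₁], ?_⟩
    rw [hf, hg]
    exact e₁ ▸ e₂ ▸ key

/-- A generating Peiffer square closes the diagram, with an identity as continuation of `f` and all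
of its bottom as continuation of `g`. -/
theorem IsPeifferModulo.gammaConfluent {b : Branching P} (h : b.IsPeifferModulo) :
    b.GammaConfluent Γ := by
  obtain ⟨hg, i, hi, f, e, -, -, h⟩ := h
  rcases h with ⟨hfe, hf, he⟩ | ⟨hfe, hf, he⟩
  · have h₁ : P.base.free.tgt i (cod f) = P.base.free.src i (dom e) := by
      rw [tgt_dom_cod hi, hfe]
    have h₂ : P.base.free.tgt i (dom f) = P.base.free.src i (cod e) := by
      rw [src_dom_cod hi, hfe]
    have d₁ := dom_comp_lt (x := f) (y := P.hid (dom e)) hi hfe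
    have d₂ := dom_comp_lt (x := P.vid (dom f)) (y := e) hi hfe
    have d₃ := dom_comp_lt (x := P.vid (cod f)) (y := e) hi h₁
    have d₄ := dom_comp_lt (x := f) (y := P.hid (cod e)) hi h₂
    have hd : dom b.g = dom (comp i f (P.hid (cod e))) := by
      rw [b.dom_g, he, d₂.2, d₄.1]; rfl
    refine ⟨P.hid (cod b.f), comp i f (P.hid (cod e)), comp i (P.vid (cod f)) e, rfl, ?_, ?_, ?_,
      ?_⟩
    · rw [← hg.dom_eq_cod, hd]
    · rw [hf, d₃.1, cod_unit, d₁.2]; rfl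
    · rw [d₃.2, d₄.2]; rfl
    · rw [comp_top_unit rfl, hg, unit_comp_top hd, hf, he]
      exact ⟨SquareCell.peifferHV i hi f e hfe⟩
  · have h₁ : P.base.free.tgt i (dom e) = P.base.free.src i (cod f) := by
      rw [src_dom_cod hi, hfe]
    have h₂ : P.base.free.tgt i (cod e) = P.base.free.src i (dom f) := by
      rw [tgt_dom_cod hi, hfe]
    have d₁ := dom_comp_lt (x := P.hid (dom e)) (y := f) hi hfe
    have d₂ := dom_comp_lt (x := e) (y := P.vid (dom f)) hi hfe
    have d₃ := dom_comp_lt (x := e) (y := P.vid (cod f)) hi h₁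
    have d₄ := dom_comp_lt (x := P.hid (cod e)) (y := f) hi h₂
    have hd : dom b.g = dom (comp i (P.hid (cod e)) f) := by
      rw [b.dom_g, he, d₂.2, d₄.1]; rfl
    refine ⟨P.hid (cod b.f), comp i (P.hid (cod e)) f, comp i e (P.vid (cod f)), rfl, ?_, ?_, ?_,
      ?_⟩
    · rw [← hg.dom_eq_cod, hd]
    · rw [hf, d₃.1, cod_unit, d₁.2]; rfl
    · rw [d₃.2, d₄.2]; rfl
    · rw [comp_top_unit rfl, hg, unit_comp_top hd, hf, he]
      exact ⟨SquareCell.peifferVH i hi f e hfe⟩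

/-- The branchings for which confluence is tested: `(f, g)` with `g` a primary step, or `(f, e)`
with `e` a step. -/
def IsTest (b : Branching P) : Prop :=
  IsStep b.f ∧ ((IsStepOf P.primary b.g ∧ IsIdentity b.e) ∨ (IsIdentity b.g ∧ IsStep b.e))

theorem IsTest.isLocal {b : Branching P} (h : b.IsTest) : b.IsLocal :=
  ⟨h.1, h.2.imp_left fun h => ⟨h.1.isStep, h.2⟩⟩

open Classical in
-- Whiskers preserve weights, so counting generators of `g` shows that a whisker neither turns an
-- identity into a step nor a step on a non-primary rule into a primary one.
theorem IsTest.of_sub {b b' : Branching P} (h : b.IsTest) (hb : b'.Sub b) (hb' : b'.IsLocal) :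
    b'.IsTest := by
  obtain ⟨W, hW, hf, he, hg⟩ := hb
  have hWg : W.Fits (dom b'.g) := by
    rw [b'.dom_g]
    exact (b'.dom_f ▸ hW : W.Fits (dom b'.e)).cod
  have hw := fun w => weight_act w hWg
  rw [hg] at hw
  refine ⟨hb'.1, ?_⟩
  rcases h.2 with h | h
  -- This weight counts the primary generators. It is 1 on the large branching, so the smaller `g`
  -- is neither an identity nor a step on a rule that is not primary.
  · have hw' := hw fun γ => if γ ∈ P.primary then 1 else 0
    rw [h.1.weight (a := 1) _ fun γ hγ => if_pos hγ] at hw'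
    rcases hb'.2 with k | k
    · refine Or.inl ⟨?_, k.2⟩
      obtain ⟨γ, -, V, hV, hγ⟩ := k.1
      refine ⟨γ, ?_, V, hV, hγ⟩
      rw [hγ, weight_act (x := gen _ γ) _ hV, weight_gen] at hw'
      by_contra hn
      rw [if_neg hn] at hw'
      exact one_ne_zero hw'
    · rw [k.1.weight] at hw'
      exact absurd hw' one_ne_zero
  · rcases hb'.2 with k | k
    · have := (hw fun _ => 1).trans k.1.size
      rw [h.1.weight] at this
      exact absurd this zero_ne_one
    · exact Or.inr k

/-- If the critical test branchings are confluent, so are all test branchings. -/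
theorem IsTest.gammaConfluent
    (h : ∀ b : Branching P, b.IsCritical → b.IsTest → b.GammaConfluent Γ) {b : Branching P}
    (hb : b.IsTest) : b.GammaConfluent Γ := by
  obtain ⟨G⟩ := Grading.nonempty_polygraph P.base
  -- Minimality for `⊑` comes from a well-founded measure of the source, available because the base
  -- is freely generated by a polygraph.
  induction hx : G.measure (dom b.f) using WellFoundedLT.induction generalizing b with
  | ind x ih =>
    subst hx
    by_cases hc : b.IsCritical
    · exact h b hc hb
    by_cases ho : b.IsOverlapping
    · have : ∃ b' : Branching P, b'.IsLocal ∧ b'.Sub b ∧ b' ≠ b := by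
        by_contra hn
        push Not at hn
        exact hc ⟨ho, hn⟩
      obtain ⟨b', hl, hs, hne⟩ := this
      -- The smaller branching is again a test, and being different it has a source of strictly
      -- smaller measure.
      exact GammaConfluent.of_sub
        (ih _ ((hs.measure_lt_or_eq G).resolve_right hne) (hb.of_sub hs hl) rfl) hs
    · by_cases h₁ : b.IsAspherical
      · exact h₁.gammaConfluent
      by_cases h₂ : b.IsPeiffer
      · exact h₂.gammaConfluent
      by_cases h₃ : b.IsPeifferModulo
      · exact h₃.gammaConfluent
      exact absurd ⟨hb.isLocal, h₁, h₂, h₃⟩ ho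

end Branching

namespace PolygraphModulo

open FreeExt

variable {m : ℕ} {P : PolygraphModulo.{u} m} {Γ : SquareExt P}

/-! ### Termination modulo -/

/-- A step of `S` between cells of `E⊤`. -/
def ModStep (P : PolygraphModulo.{u} m) (u w : P.base.free.Cell) : Prop :=
  ∃ (e : P.VCell) (f : P.HCell) (d : P.VCell), IsStep f ∧ dom e = u ∧ cod e = dom f ∧
    cod f = dom d ∧ cod d = w

/-- A step of `S` is a whisker around a triple `(pre, rule, post)`. Whiskering the three components
and absorbing the surrounding cells of `E⊤` into the outer two gives one generator of `ᴇRᴇ`, which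
is not an identity because it has size one. -/
theorem ModStep.reduces {u w : P.base.free.Cell} (h : P.ModStep u w) :
    (P.R.ere P.E).Reduces u w := by
  obtain ⟨e, f, d, ⟨γ, -, W, hW, rfl⟩, rfl, he, hd, rfl⟩ := h
  have hW₁ : W.Fits (dom γ.1.pre) := hW
  have hW₂ : W.Fits (dom γ.1.rule) := γ.1.pre_rule ▸ hW₁.cod
  have hW₃ : W.Fits (dom γ.1.post) := γ.1.rule_post ▸ hW₂.cod
  have h₁ : cod e = dom (W.act γ.1.pre) := by
    rw [he, Whisker.dom_act (x := gen _ γ) hW, Whisker.dom_act hW₁]; rfl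
  have h₂ : cod (W.act γ.1.post) = dom d := by
    rw [← hd, Whisker.cod_act (x := gen _ γ) hW, Whisker.cod_act hW₃]; rfl
  let δ : EREGen P.R P.E :=
    { pre := comp m e (W.act γ.1.pre)
      rule := W.act γ.1.rule
      post := comp m (W.act γ.1.post) d
      isStep := IsStepOf.act γ.1.isStep hW₂
      pre_rule := by
        rw [cod_comp h₁, Whisker.cod_act hW₁, Whisker.dom_act hW₂, γ.1.pre_rule]
      rule_post := by
        rw [dom_comp h₂, Whisker.cod_act hW₂, Whisker.dom_act hW₃, γ.1.rule_post] }
  exact ⟨gen (Γ := P.R.ere P.E) _ δ, (isStep_gen (Γ := P.R.ere P.E) δ).not_isIdentity,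
    dom_comp h₁, cod_comp h₂⟩

/-- The transitive closure of the relation of rewriting modulo. -/
def Below (P : PolygraphModulo.{u} m) : P.base.free.Cell → P.base.free.Cell → Prop :=
  Relation.TransGen P.ModStep

theorem wellFounded_below (h : (P.R.ere P.E).Terminating) :
    WellFounded fun w u => P.Below u w := by
  have hwf : WellFounded fun w u => P.ModStep u w := by
    rw [wellFounded_iff_isEmpty_descending_chain]
    exact ⟨fun f => h ⟨f.1, fun k => (f.2 k).reduces⟩⟩
  have : (fun w u => P.Below u w) = Relation.TransGen fun w u => P.ModStep u w := by
    ext w u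
    exact Relation.transGen_swap.symm
  rw [this]
  exact hwf.transGen

theorem below_of_step {u : P.base.free.Cell} {e : P.VCell} {f : P.HCell} (hf : IsStep f)
    (he : dom e = u) (h : cod e = dom f) : P.Below u (cod f) :=
  Relation.TransGen.single ⟨e, f, P.vid (cod f), hf, he, h, rfl, rfl⟩

/-- A step modulo ends with an arbitrary cell of `E⊤`, which can absorb `d`. -/
theorem Below.vertical {u w : P.base.free.Cell} (h : P.Below u w) {d : P.VCell}
    (hd : dom d = w) : P.Below u (cod d) := by
  have key : ∀ v, P.ModStep v w → P.ModStep v (cod d) := by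
    rintro v ⟨e, f, c, hf, he, hef, hfc, hc⟩
    have hcd : cod c = dom d := by rw [hc, hd]
    exact ⟨e, f, comp m c d, hf, he, hef, by rw [dom_comp hcd, hfc], cod_comp hcd⟩
  cases h with
  | single h => exact Relation.TransGen.single (key _ h)
  | tail h h' => exact Relation.TransGen.tail h (key _ h')

theorem Below.horizontal {u : P.base.free.Cell} {f : P.HCell} (h : P.Below u (dom f)) :
    P.Below u (cod f) := by
  have hp := isPath f
  induction hp with
  | unit c => exact h
  | cons hx hxy _ ih =>
    rw [dom_comp hxy] at h
    rw [cod_comp hxy]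
    refine ih ?_
    rw [← hxy]
    exact h.trans (below_of_step (e := P.vid _) hx rfl rfl)

/-! ### Normal forms -/

/-- No step of `S` starts at `u`. -/
def IsNormal (P : PolygraphModulo.{u} m) (u : P.base.free.Cell) : Prop :=
  ∀ f : P.HCell, IsStep f → dom f ≠ u

theorem exists_isNormal (hwf : WellFounded fun w u => P.Below u w) (u : P.base.free.Cell) :
    ∃ h : P.HCell, dom h = u ∧ P.IsNormal (cod h) := by
  induction u using hwf.induction with
  | h u ih =>
    by_cases hu : P.IsNormal u
    · exact ⟨P.hid u, rfl, hu⟩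
    · simp only [IsNormal, not_forall, not_not] at hu
      obtain ⟨f, hf, rfl⟩ := hu
      obtain ⟨h, hh, hn⟩ := ih (cod f) (below_of_step (e := P.vid _) hf rfl rfl)
      exact ⟨comp m f h, dom_comp hh.symm, by rwa [cod_comp hh.symm]⟩

theorem isIdentity_or_exists_step (f : P.HCell) : IsIdentity f ∨
    ∃ f₁ f₂ : P.HCell, IsStep f₁ ∧ cod f₁ = dom f₂ ∧ f = comp m f₁ f₂ := by
  cases isPath f with
  | unit c => exact Or.inl (isIdentity_unit c)
  | cons hx h _ => exact Or.inr ⟨_, _, hx, h, rfl⟩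

/-- Every step of `S` starts with a cell of `E⊤` into the source of a primary step. -/
theorem exists_primary {g : P.HCell} (hg : IsStep g) : ∃ (e : P.VCell) (p : P.HCell),
    IsStepOf P.primary p ∧ dom e = dom g ∧ cod e = dom p := by
  obtain ⟨γ, -, W, hW, rfl⟩ := hg
  obtain ⟨ρ, -, V, hV, hρ⟩ := γ.1.isStep
  have hW₁ : W.Fits (dom γ.1.pre) := hW
  have hW₂ : W.Fits (dom γ.1.rule) := γ.1.pre_rule ▸ hW₁.cod
  -- The rule component of the generator is a whiskered `ρ` in `R`. As `R ⊆ S`, the same whisker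
  -- around `(1, ρ, 1)` is a primary step of `S`, reached by the whiskered first component of the
  -- triple.
  let σ : P.S.Gen := ⟨EREGen.ofRule P.E ρ, P.rule_mem ρ⟩
  have hVσ : V.Fits (dom (gen (Γ := P.S) (fun _ _ => False) σ)) := hV
  have hd : dom (V.act (gen (Γ := P.S) (fun _ _ => False) σ)) = dom γ.1.rule := by
    rw [hρ, Whisker.dom_act hVσ, Whisker.dom_act (x := gen _ ρ) hV]; rfl
  have hWσ : W.Fits (dom (V.act (gen (Γ := P.S) (fun _ _ => False) σ))) := hd ▸ hW₂
  refine ⟨W.act γ.1.pre, W.act (V.act (gen _ σ)), ?_, ?_, ?_⟩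
  · have hσ : IsStepOf P.primary (V.act (gen (Γ := P.S) (fun _ _ => False) σ)) :=
      ⟨σ, ⟨ρ, rfl⟩, V, hV, rfl⟩
    exact hσ.act hWσ
  · rw [Whisker.dom_act hW₁, Whisker.dom_act (x := gen _ γ) hW]; rfl
  · rw [Whisker.cod_act hW₁, Whisker.dom_act hWσ, hd, γ.1.pre_rule]

/-! ### Coherent confluence -/

/-- The configuration `(f, e, g)` can be completed to a square. -/
def Joins (Γ : SquareExt P) (f : P.HCell) (e : P.VCell) (g : P.HCell) : Prop :=
  ∃ f' g' right, cod f = dom f' ∧ cod g = dom g' ∧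
    BoundsSquare Γ (comp m f f') (comp m g g') e right

/-- Any two reductions to normal forms that start with `f` and with `g` bound a square over `e`. -/
structure Coherent (Γ : SquareExt P) (f : P.HCell) (e : P.VCell) (g : P.HCell) : Prop where
  dom_eq : dom e = dom f
  cod_eq : cod e = dom g
  square : ∀ f' g', cod f = dom f' → cod g = dom g' → P.IsNormal (cod f') →
    P.IsNormal (cod g') → ∃ right, BoundsSquare Γ (comp m f f') (comp m g g') e right

/-- Any two reductions to normal forms, of `u` and of a cell equivalent to `u` modulo `E`, bound a
square. -/
def CoherentAt (Γ : SquareExt P) (u : P.base.free.Cell) : Prop :=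
  ∀ (f g : P.HCell) (e : P.VCell), dom f = u → dom e = u → cod e = dom g → P.IsNormal (cod f) →
    P.IsNormal (cod g) → ∃ e', BoundsSquare Γ f g e e'

theorem Coherent.symm {f g : P.HCell} {e d : P.VCell} (h : Coherent Γ f e g)
    (hd : IsInverse e d) : Coherent Γ g d f := by
  refine ⟨by rw [← hd.1, h.cod_eq], by rw [hd.2.1, h.dom_eq], fun g' f' hg hf ng nf => ?_⟩
  obtain ⟨e', he'⟩ := h.square f' g' hf hg nf ng
  obtain ⟨d', hd'⟩ := exists_isInverse e'
  exact ⟨d', he'.invH hd hd'⟩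

/-- A reduction of `g` to a normal form, which termination provides, serves as the common side of
the two squares. Because `Coherent` quantifies over all such reductions, the same one can be used in
both. -/
theorem Coherent.trans (hwf : WellFounded fun w u => P.Below u w) {f g h : P.HCell}
    {e d : P.VCell} (hfg : Coherent Γ f e g) (hgh : Coherent Γ g d h) :
    Coherent Γ f (comp m e d) h := by
  have hed : cod e = dom d := by rw [hfg.cod_eq, hgh.dom_eq]
  refine ⟨by rw [dom_comp hed, hfg.dom_eq], by rw [cod_comp hed, hgh.cod_eq],
    fun f' h' hf hh nf nh => ?_⟩
  obtain ⟨g', hg, ng⟩ := exists_isNormal hwf (cod g)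
  obtain ⟨e', he'⟩ := hfg.square f' g' hf hg.symm nf ng
  obtain ⟨d', hd'⟩ := hgh.square g' h' hg.symm hh ng nh
  exact ⟨_, he'.compH hd'⟩

theorem CoherentAt.coherent_refl {f : P.HCell} (h : CoherentAt Γ (cod f)) :
    Coherent Γ f (P.vid (dom f)) f := by
  refine ⟨rfl, rfl, fun f' g' hf hg nf ng => ?_⟩
  obtain ⟨e', he'⟩ := h f' g' (P.vid (cod f)) hf.symm rfl hg nf ng
  exact ⟨e', (BoundsSquare.idH f).compV he'⟩

/-- The Newman diagram. The given square is prolonged to normal forms by the induction hypothesis at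
the target of `a`; the hypotheses at the targets of `f` and of `g` then replace the particular
reductions so obtained by arbitrary ones. The cell `u` need not be the source of `f`; only the
targets have to lie below it. -/
theorem Joins.coherent (hwf : WellFounded fun w u => P.Below u w) {u : P.base.free.Cell}
    (H : ∀ w, P.Below u w → CoherentAt Γ w) {f g : P.HCell} {e : P.VCell}
    (he : dom e = dom f) (he' : cod e = dom g) (hf : P.Below u (cod f)) (hg : P.Below u (cod g))
    (h : Joins Γ f e g) : Coherent Γ f e g := by
  obtain ⟨a, b, d, ha, hb, A⟩ := h
  obtain ⟨a', ha', na⟩ := exists_isNormal hwf (cod a)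
  obtain ⟨b', hb', nb⟩ := exists_isNormal hwf (cod b)
  have hda : dom d = cod a := by rw [A.dom_right, cod_comp ha]
  have hdb : cod d = cod b := by rw [A.cod_right, cod_comp hb]
  have hcA : P.Below u (cod a) := Below.horizontal (ha ▸ hf)
  obtain ⟨d', B⟩ := H _ hcA a' b' d ha' hda (by rw [hdb, hb']) na nb
  have D := A.compV B
  rw [comp_top_assoc ha ha'.symm, comp_top_assoc hb hb'.symm] at D
  refine ⟨he, he', fun f' g' hf' hg' nf ng => ?_⟩
  have ca : cod f = dom (comp m a a') := by rw [dom_comp ha'.symm, ha]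
  have cb : cod g = dom (comp m b b') := by rw [dom_comp hb'.symm, hb]
  obtain ⟨c₁, A₁⟩ := (H _ hf).coherent_refl.square f' (comp m a a') hf' ca nf
    (by rwa [cod_comp ha'.symm])
  obtain ⟨c₂, A₂⟩ := (H _ hg).coherent_refl.square (comp m b b') g' cb hg'
    (by rwa [cod_comp hb'.symm]) ng
  -- Three squares are stacked: `f'` against `a ⋆ₘ a'`, the prolonged join, and `b ⋆ₘ b'` against
  -- `g'`. The outer two have identities on the left.
  have key := (A₁.compH D).compH A₂
  rw [unit_comp_top he.symm, comp_top_unit he'] at key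
  exact ⟨_, key⟩

/-- By termination, a completed configuration `(f, e)` involves a step at the target of `e`. -/
theorem Joins.exists_step (hwf : WellFounded fun w u => P.Below u w) {f : P.HCell} {e : P.VCell}
    (hf : IsStep f) (he : dom e = dom f) (h : Joins Γ f e (P.hid (cod e))) :
    ∃ g : P.HCell, IsStep g ∧ cod e = dom g ∧ Joins Γ f e g := by
  obtain ⟨a, b, d, ha, hb, A⟩ := h
  change cod e = dom b at hb
  rw [unit_comp_top hb] at A
  rcases isIdentity_or_exists_step b with hi | ⟨b₁, b₂, h₁, h₁₂, rfl⟩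
  -- If the bottom were an identity, going back along `e`, reducing by `f` and `a`, and descending
  -- along `d` would place the target of `e` strictly below itself.
  · obtain ⟨e', hinv⟩ := exists_isInverse e
    have h₁ : P.Below (cod e) (cod f) := below_of_step hf hinv.1.symm (by rw [hinv.2.1, he])
    have h₂ : P.Below (cod e) (cod a) := Below.horizontal (ha ▸ h₁)
    have h₃ := h₂.vertical (d := d) (by rw [A.dom_right, cod_comp ha])
    rw [A.cod_right, ← hi.dom_eq_cod, ← hb] at h₃
    exact absurd h₃ (hwf.irrefl.irrefl _)
  · exact ⟨b₁, h₁, by rw [hb, dom_comp h₁₂], a, b₂, d, ha, h₁₂, A⟩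

/-- Local confluence of a step with a primary step, and of a step with a step of `E⊤`. -/
structure TestJoins (Γ : SquareExt P) : Prop where
  primary : ∀ f g : P.HCell, IsStep f → IsStepOf P.primary g → dom f = dom g →
    Joins Γ f (P.vid (dom f)) g
  vertical : ∀ (f : P.HCell) (e : P.VCell), IsStep f → IsStep e → dom e = dom f →
    Joins Γ f e (P.hid (cod e))

/-- A step of `S` travels along `e` one step of `E⊤` at a time, each time replaced by a coherent
step at the next source. The cell `d` links the moving source to the fixed `u`, so that the
induction hypothesis below `u` remains applicable. -/
theorem TestJoins.transport (hwf : WellFounded fun w u => P.Below u w) (hJ : TestJoins Γ)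
    {u : P.base.free.Cell} (H : ∀ w, P.Below u w → CoherentAt Γ w)
    {e : P.VCell} (he : IsPath e) :
    ∀ {f : P.HCell} {d : P.VCell}, IsStep f → dom d = u → cod d = dom f → dom e = dom f →
      ∃ g : P.HCell, IsStep g ∧ Coherent Γ f e g := by
  induction he with
  | unit c =>
    intro f d hf hd hdf hc
    refine ⟨f, hf, ?_⟩
    have := (H _ (below_of_step hf hd hdf)).coherent_refl
    rwa [← hc] at this
  | @cons x y hx hxy _ ih =>
    intro f d hf hd hdf hc
    rw [dom_comp hxy] at hc
    obtain ⟨g, hg, hxg, J⟩ := (hJ.vertical f x hf hx hc).exists_step hwf hf hc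
    have hdx : cod d = dom x := by rw [hdf, hc]
    have hdu : dom (comp m d x) = u := by rw [dom_comp hdx, hd]
    have hdg : cod (comp m d x) = dom g := by rw [cod_comp hdx, hxg]
    have hfg := J.coherent hwf H hc hxg (below_of_step hf hd hdf) (below_of_step hg hdu hdg)
    obtain ⟨h, hh, hgh⟩ := ih hg hdu hdg (by rw [← hxy, hxg])
    exact ⟨h, hh, hfg.trans hwf hgh⟩

/-- Steps of `S` cohere with primary steps. -/
theorem TestJoins.coherent_primary (hwf : WellFounded fun w u => P.Below u w) (hJ : TestJoins Γ)
    {u : P.base.free.Cell} (H : ∀ w, P.Below u w → CoherentAt Γ w)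
    {f p : P.HCell} {d e : P.VCell} (hf : IsStep f)
    (hp : IsStepOf P.primary p) (hd : dom d = u) (hdf : cod d = dom f) (hef : dom e = dom f)
    (hep : cod e = dom p) : Coherent Γ f e p := by
  -- Transport brings `f` to a step with the same source as `p`, where the two can be compared
  -- without a vertical cell.
  obtain ⟨g, hg, hfg⟩ := hJ.transport hwf H (isPath e) hf hd hdf hef
  have hgp : dom g = dom p := by rw [← hfg.cod_eq, hep]
  have hde : cod d = dom e := by rw [hdf, hef]
  have hdu : dom (comp m d e) = u := by rw [dom_comp hde, hd]
  have hcp : cod (comp m d e) = dom p := by rw [cod_comp hde, hep]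
  have hcg : cod (comp m d e) = dom g := by rw [hcp, hgp]
  have hgp' : Coherent Γ g (P.vid (dom g)) p := (hJ.primary g p hg hp hgp).coherent hwf H rfl hgp
    (below_of_step hg hdu hcg) (below_of_step hp.isStep hdu hcp)
  have key := hfg.trans hwf hgp'
  rwa [comp_top_unit hfg.cod_eq] at key

/-- Both steps cohere with one primary step `p`, the step `f` over `e ⋆ₘ c` and `g` over `c`.
Reversing the second comparison cancels `c`. -/
theorem TestJoins.coherent_step (hwf : WellFounded fun w u => P.Below u w) (hJ : TestJoins Γ)
    {u : P.base.free.Cell} (H : ∀ w, P.Below u w → CoherentAt Γ w)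
    {f g : P.HCell} {e : P.VCell} (hf : IsStep f) (hg : IsStep g)
    (he : dom e = u) (hef : dom e = dom f) (heg : cod e = dom g) : Coherent Γ f e g := by
  obtain ⟨c, p, hp, hcg, hcp⟩ := exists_primary hg
  obtain ⟨c', hc⟩ := exists_isInverse c
  have hec : cod e = dom c := by rw [heg, hcg]
  have h₁ := hJ.coherent_primary hwf H (d := P.vid u) (e := comp m e c) hf hp rfl
    (by rw [← hef, he]; rfl) (by rw [dom_comp hec, hef]) (by rw [cod_comp hec, hcp])
  have h₂ := hJ.coherent_primary hwf H (d := e) (e := c) hg hp he heg hcg hcp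
  have key := h₁.trans hwf (h₂.symm hc)
  rwa [comp_top_assoc hec hc.1, hc.2.2.1, comp_top_unit hec] at key

/-- When both reductions start with steps, the coherence of these steps is the claim. Two identities
bound the identity square on `e`, and the mixed cases are excluded by transport. -/
theorem TestJoins.coherentAt (hwf : WellFounded fun w u => P.Below u w) (hJ : TestJoins Γ)
    {u : P.base.free.Cell} (H : ∀ w, P.Below u w → CoherentAt Γ w) :
    CoherentAt Γ u := by
  intro f g e hf he hg nf ng
  rcases isIdentity_or_exists_step f with hi | ⟨f₁, f₂, h₁, h₁₂, rfl⟩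
  · rcases isIdentity_or_exists_step g with hj | ⟨g₁, g₂, k₁, k₁₂, rfl⟩
    · rw [hi, hj, hf, ← he, ← hg]
      exact ⟨e, BoundsSquare.idV e⟩
    · obtain ⟨d, hd⟩ := exists_isInverse e
      rw [dom_comp k₁₂] at hg
      -- The first step of `g` would travel back along the inverse of `e` to a step out of the
      -- source of `f`, which is normal since `f` is an identity.
      obtain ⟨h, hh, hgh⟩ := hJ.transport hwf H (isPath d) k₁ he hg (by rw [← hd.1, hg])
      refine absurd ?_ (nf h hh)
      rw [← hgh.cod_eq, hd.2.1, he, ← hf, hi.dom_eq_cod]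
  · rw [dom_comp h₁₂] at hf
    rcases isIdentity_or_exists_step g with hj | ⟨g₁, g₂, k₁, k₁₂, rfl⟩
    -- Symmetrically, the first step of `f` would travel along `e` to the source of `g`, which is
    -- normal.
    · obtain ⟨h, hh, hfh⟩ := hJ.transport hwf H (isPath e) (d := P.vid u) h₁ rfl hf.symm
        (by rw [he, hf])
      refine absurd ?_ (ng h hh)
      rw [← hfh.cod_eq, hg, hj.dom_eq_cod]
    · rw [dom_comp k₁₂] at hg
      rw [cod_comp h₁₂] at nf
      rw [cod_comp k₁₂] at ng
      exact (hJ.coherent_step hwf H h₁ k₁ he (by rw [he, hf]) hg).square f₂ g₂ h₁₂ k₁₂ nf ng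

/-- Global confluence: both branches are continued to normal forms, and coherence holds at every
cell by induction along `Below`. -/
theorem TestJoins.joins (hwf : WellFounded fun w u => P.Below u w) (hJ : TestJoins Γ)
    {f g : P.HCell} {e : P.VCell} (hf : dom f = dom e) (hg : dom g = cod e) : Joins Γ f e g := by
  obtain ⟨f', hf', nf⟩ := exists_isNormal hwf (cod f)
  obtain ⟨g', hg', ng⟩ := exists_isNormal hwf (cod g)
  -- The well-founded induction that discharges the hypotheses `H` of the preceding lemmas.
  have key : CoherentAt Γ (dom f) := by
    induction dom f using hwf.induction with
    | h u ih => exact hJ.coherentAt hwf ih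
  obtain ⟨e', he'⟩ := key (comp m f f') (comp m g g') e (dom_comp hf'.symm) hf.symm
    (by rw [dom_comp hg'.symm, hg]) (by rwa [cod_comp hf'.symm]) (by rwa [cod_comp hg'.symm])
  exact ⟨f', g', e', hf'.symm, hg'.symm, he'⟩

theorem TestJoins.of_isTest (h : ∀ b : Branching P, b.IsTest → b.GammaConfluent Γ) :
    TestJoins Γ where
  primary f g hf hg hfg := Branching.gammaConfluent_iff.1 <|
    h ⟨f, P.vid (dom f), g, rfl, hfg.symm, hf.not_isIdentity⟩
      ⟨hf, Or.inl ⟨hg, isIdentity_unit _⟩⟩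
  vertical f e hf he hfe := Branching.gammaConfluent_iff.1 <|
    h ⟨f, e, P.hid (cod e), hfe.symm, rfl, hf.not_isIdentity⟩
      ⟨hf, Or.inr ⟨isIdentity_unit _, he⟩⟩

end PolygraphModulo

/-- The coherent critical branching lemma modulo. -/
theorem theoremT {m : ℕ} (P : PolygraphModulo.{u} m) (hterm : (P.R.ere P.E).Terminating)
    (Γ : SquareExt P) :
    P.LocallyGammaConfluent Γ ↔
      (∀ b : Branching P, b.IsCritical → FreeExt.IsStep b.f →
        FreeExt.IsStepOf P.primary b.g → FreeExt.IsIdentity b.e → b.GammaConfluent Γ) ∧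
      (∀ b : Branching P, b.IsCritical → FreeExt.IsStep b.f →
        FreeExt.IsStep b.e → FreeExt.IsIdentity b.g → b.GammaConfluent Γ) := by
  refine ⟨fun h => ⟨fun b hb _ _ _ => h b hb.1.1, fun b hb _ _ _ => h b hb.1.1⟩, ?_⟩
  rintro ⟨ha, hb⟩ b -
  have hJ : PolygraphModulo.TestJoins Γ := PolygraphModulo.TestJoins.of_isTest fun b ht =>
    ht.gammaConfluent fun b hc ht => by
      rcases ht with ⟨hf, h | h⟩
      · exact ha b hc hf h.1 h.2
      · exact hb b hc hf h.2 h.1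
  exact Branching.gammaConfluent_iff.2
    (hJ.joins (PolygraphModulo.wellFounded_below hterm) b.dom_f b.dom_g)
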